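/- **Chevalley restriction theorem.** For a finite-dimensional complex vector space $V$ let $\mathbb C[V]$ be the algebra of polynomial functions on $V$, graded by degree. Let $\mathfrak g$ be a finite-dimensional complex semisimple Lie algebra, $\mathfrak h\subset\mathfrak g$ a Cartan subalgebra, and $W$ the Weyl group of the root system of $(\mathfrak g,\mathfrak h)$, acting on $\mathfrak h$. Let $\mathfrak g$ act on $\mathbb C[\mathfrak g]$ by the derivations $(x\cdot F)(y)=\frac{d}{dt}\big|_{t=0}F(y-t[x,y])$, let $W$ act on $\mathbb C[\mathfrak h]$ by $(w\cdot f)(h)=f(w^{-1}h)$, and let $\mathbb C[\mathfrak g]^{\mathfrak g}=\{F: x\cdot F=0\ \ \forall x\in\mathfrak g\}$ and $\mathbb C[\mathfrak h]^W=\{f: w\cdot f=f\ \ \forall w\in W\}$ be the algebras of invariants. For $F\in\mathbb C[\mathfrak g]^{\mathfrak g}$ let $\mathrm{Res}(F)=F|_{\mathfrak h}$. Then: (i) $\mathrm{Res}(F)\in\mathbb C[\mathfrak h]^W$ for every $F\in\mathbb C[\mathfrak g]^{\mathfrak g}$. (ii) $\mathbb C[\mathfrak g]^{\mathfrak g}$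 and $\mathbb C[\mathfrak h]^W$ are graded subalgebras of $\mathbb C[\mathfrak g]$ and $\mathbb C[\mathfrak h]$, and $\mathrm{Res}:\mathbb C[\mathfrak g]^{\mathfrak g}\to\mathbb C[\mathfrak h]^W$ is an isomorphism of graded algebras: it is an algebra isomorphism which, for every $n\ge 0$, maps the homogeneous invariants of degree $n$ on $\mathfrak g$ onto the homogeneous $W$-invariants of degree $n$ on $\mathfrak h$. -/

import Mathlib

namespace ChevalleyRestriction

noncomputable section

open Module

/-- `ℂ[V]`: the algebra of polynomial functions on a complex vector space `V`, i.e. the algebra of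
functions `V → ℂ` generated by the linear functionals. -/
def PolyFun (V : Type*) [AddCommGroup V] [Module ℂ V] : Subalgebra ℂ (V → ℂ) :=
  Algebra.adjoin ℂ (Set.range fun l : Dual ℂ V => (l : V → ℂ))

section PolyFun

variable {V U : Type*} [AddCommGroup V] [Module ℂ V] [AddCommGroup U] [Module ℂ U]

variable (V) in
/-- The inclusion of the linear functionals `V* → ℂ[V]`. -/
def linearPart : Dual ℂ V →ₗ[ℂ] PolyFun V where
  toFun l := ⟨l, Algebra.subset_adjoin ⟨l, rfl⟩⟩
  map_add' _ _ := rfl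
  map_smul' _ _ := rfl

variable (V) in
/-- The homogeneous polynomial functions of degree `n`: the linear span in `ℂ[V]` of the products
of `n` linear functionals. -/
def homogeneous (n : ℕ) : Submodule ℂ (PolyFun V) :=
  LinearMap.range (linearPart V) ^ n

/-- The degree `n` part `A ∩ ℂ[V]ₙ` of a subalgebra `A` of `ℂ[V]`. -/
def degreePart (A : Subalgebra ℂ (PolyFun V)) (n : ℕ) : Submodule ℂ A :=
  (homogeneous V n).comap A.val.toLinearMap

theorem comp_mem (f : U →ₗ[ℂ] V) {F : V → ℂ} (hF : F ∈ PolyFun V) : F ∘ f ∈ PolyFun U := by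
  induction hF using Algebra.adjoin_induction with
  | mem F hF =>
    obtain ⟨l, rfl⟩ := hF
    exact Algebra.subset_adjoin ⟨l ∘ₗ f, rfl⟩
  | algebraMap r => exact (PolyFun U).algebraMap_mem r
  | add F G _ _ h₁ h₂ => exact add_mem h₁ h₂
  | mul F G _ _ h₁ h₂ => exact mul_mem h₁ h₂

/-- Pullback `F ↦ F ∘ f` of polynomial functions along a linear map `f : U → V`. -/
def pullback (f : U →ₗ[ℂ] V) : PolyFun V →ₐ[ℂ] PolyFun U where
  toFun F := ⟨(F : V → ℂ) ∘ f, comp_mem f F.2⟩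
  map_one' := rfl
  map_mul' _ _ := rfl
  map_zero' := rfl
  map_add' _ _ := rfl
  commutes' _ := rfl

theorem pullback_id : pullback (LinearMap.id : V →ₗ[ℂ] V) = AlgHom.id ℂ (PolyFun V) := rfl

theorem pullback_mul (f g : End ℂ V) : pullback (g * f) = (pullback f).comp (pullback g) := rfl

theorem lineDifferentiableAt {F : V → ℂ} (hF : F ∈ PolyFun V) (y v : V) :
    LineDifferentiableAt ℂ F y v := by
  induction hF using Algebra.adjoin_induction with
  | mem F hF =>
    obtain ⟨l, rfl⟩ := hF
    simp only [LineDifferentiableAt, map_add, map_smul, smul_eq_mul]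
    fun_prop
  | algebraMap r => exact differentiableAt_const r
  | add F G _ _ h₁ h₂ => exact DifferentiableAt.add h₁ h₂
  | mul F G _ _ h₁ h₂ => exact DifferentiableAt.mul h₁ h₂

theorem lineDeriv_linear (l : Dual ℂ V) (y v : V) : lineDeriv ℂ (l : V → ℂ) y v = l v := by
  simp [lineDeriv]

theorem lineDeriv_add {F G : V → ℂ} (hF : F ∈ PolyFun V) (hG : G ∈ PolyFun V) (y v : V) :
    lineDeriv ℂ (F + G) y v = lineDeriv ℂ F y v + lineDeriv ℂ G y v :=
  deriv_add (lineDifferentiableAt hF y v) (lineDifferentiableAt hG y v)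

theorem lineDeriv_mul {F G : V → ℂ} (hF : F ∈ PolyFun V) (hG : G ∈ PolyFun V) (y v : V) :
    lineDeriv ℂ (F * G) y v = F y * lineDeriv ℂ G y v + G y * lineDeriv ℂ F y v := by
  have := deriv_mul (lineDifferentiableAt hF y v) (lineDifferentiableAt hG y v)
  simp only [zero_smul, add_zero] at this
  rw [mul_comm (G y), add_comm]
  exact this

theorem lineDeriv_mem (A : End ℂ V) {F : V → ℂ} (hF : F ∈ PolyFun V) :
    (fun y => lineDeriv ℂ F y (A y)) ∈ PolyFun V := by
  induction hF using Algebra.adjoin_induction with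
  | mem F hF =>
    obtain ⟨l, rfl⟩ := hF
    simp only [lineDeriv_linear]
    exact Algebra.subset_adjoin ⟨l ∘ₗ A, rfl⟩
  | algebraMap r =>
    have : (fun y => lineDeriv ℂ (algebraMap ℂ (V → ℂ) r) y (A y)) = 0 :=
      funext fun _ => deriv_const (0 : ℂ) r
    exact this ▸ (PolyFun V).zero_mem
  | add F G hF hG h₁ h₂ =>
    simp only [lineDeriv_add hF hG]
    exact add_mem h₁ h₂
  | mul F G hF hG h₁ h₂ =>
    simp only [lineDeriv_mul hF hG]
    exact add_mem (mul_mem hF h₂) (mul_mem hG h₁)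

/-- The derivative of polynomial functions along the linear vector field `y ↦ A y`:
`F ↦ (y ↦ d/dt F(y + t A y) at t = 0)`. -/
def vectorField (A : End ℂ V) : Derivation ℂ (PolyFun V) (PolyFun V) :=
  Derivation.mk'
    { toFun := fun F => ⟨fun y => lineDeriv ℂ (F : V → ℂ) y (A y), lineDeriv_mem A F.2⟩
      map_add' := fun F G => Subtype.ext <| funext fun y => lineDeriv_add F.2 G.2 y (A y)
      map_smul' := fun c F => Subtype.ext <| funext fun y =>
        deriv_const_smul c (lineDifferentiableAt F.2 y (A y)) }
    fun F G => Subtype.ext <| funext fun y => lineDeriv_mul F.2 G.2 y (A y)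

theorem vectorField_apply (A : End ℂ V) (F : PolyFun V) (y : V) :
    (vectorField A F : V → ℂ) y = lineDeriv ℂ (F : V → ℂ) y (A y) := rfl

theorem derivation_ext {D₁ D₂ : Derivation ℂ (PolyFun V) (PolyFun V)}
    (h : ∀ l, D₁ (linearPart V l) = D₂ (linearPart V l)) : D₁ = D₂ := by
  ext1 F
  obtain ⟨F, hF⟩ := F
  induction hF using Algebra.adjoin_induction with
  | mem F hF =>
    obtain ⟨l, rfl⟩ := hF
    exact h l
  | algebraMap r =>
    exact (D₁.map_algebraMap r).trans (D₂.map_algebraMap r).symm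
  | add F G hF hG h₁ h₂ =>
    have : (⟨F + G, add_mem hF hG⟩ : PolyFun V) = ⟨F, hF⟩ + ⟨G, hG⟩ := rfl
    exact this ▸ by rw [map_add, map_add, h₁, h₂]
  | mul F G hF hG h₁ h₂ =>
    have : (⟨F * G, mul_mem hF hG⟩ : PolyFun V) = ⟨F, hF⟩ * ⟨G, hG⟩ := rfl
    exact this ▸ by rw [Derivation.leibniz, Derivation.leibniz, h₁, h₂]

theorem vectorField_linear (A : End ℂ V) (l : Dual ℂ V) :
    vectorField A (linearPart V l) = linearPart V (l ∘ₗ A) :=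
  Subtype.ext <| funext fun y => lineDeriv_linear l y (A y)

end PolyFun

section Lie

variable (L : Type*) [LieRing L] [LieAlgebra ℂ L]

/-- The action of a Lie algebra `L` on `ℂ[L]` by derivations induced by the adjoint action:
`(x · F)(y) = d/dt F(y - t [x, y])` at `t = 0`. -/
def adjointAction : L →ₗ⁅ℂ⁆ Derivation ℂ (PolyFun L) (PolyFun L) where
  toFun x := vectorField (-LieAlgebra.ad ℂ L x)
  map_add' x y := derivation_ext fun l => by
    rw [Derivation.add_apply, vectorField_linear, vectorField_linear, vectorField_linear, ← map_add]
    congr 1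
    ext z
    simp only [LinearMap.comp_apply, LinearMap.neg_apply, LinearMap.add_apply, map_add, map_neg]
    ring
  map_smul' c x := derivation_ext fun l => by
    rw [RingHom.id_apply, Derivation.smul_apply, vectorField_linear, vectorField_linear, ← map_smul]
    congr 1
    ext z
    simp
  map_lie' {x y} := derivation_ext fun l => by
    rw [Derivation.commutator_apply]
    simp only [vectorField_linear]
    rw [← map_sub]
    congr 1
    ext z
    simp

/-- `ℂ[L]^L`: the algebra of polynomial functions on `L` invariant under the adjoint action. -/
def adjointInvariants : Subalgebra ℂ (PolyFun L) where
  carrier := {F | ∀ x : L, adjointAction L x F = 0}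
  mul_mem' {F G} hF hG x := by simp [hF x, hG x]
  add_mem' {F G} hF hG x := by simp [hF x, hG x]
  algebraMap_mem' r x := (adjointAction L x).map_algebraMap r

variable {L} in
/-- Restriction of polynomial functions from `L` to a subalgebra `H`. -/
def restrict (H : LieSubalgebra ℂ L) : PolyFun L →ₐ[ℂ] PolyFun H :=
  pullback H.toSubmodule.subtype

end Lie

section Weyl

variable {L : Type*} [LieRing L] [LieAlgebra ℂ L] [FiniteDimensional ℂ L]
  [LieAlgebra.IsSemisimple ℂ L] (H : LieSubalgebra ℂ L) [H.IsCartanSubalgebra]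

/-- The action of the Weyl group `W` on `ℂ[H]`, `(w · F)(h) = F(w⁻¹ h)`. Mathlib lets the Weyl
group act on the coweight space `H` from the right, so that `w⁻¹ h` is the map attached to `w`. -/
def weylAction : (LieAlgebra.IsKilling.rootSystem H).weylGroup →* (PolyFun H →ₐ[ℂ] PolyFun H) where
  toFun w := pullback (MulOpposite.unop
    (RootPairing.Equiv.coweightHom (LieAlgebra.IsKilling.rootSystem H) w)).toLinearMap
  map_one' := by
    rw [OneMemClass.coe_one, map_one]
    exact pullback_id
  map_mul' w₁ w₂ := by
    rw [MulMemClass.coe_mul, map_mul, MulOpposite.unop_mul]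
    exact pullback_mul _ _

/-- `ℂ[H]^W`: the algebra of polynomial functions on `H` invariant under the Weyl group. -/
def weylInvariants : Subalgebra ℂ (PolyFun H) where
  carrier := {F | ∀ w, weylAction H w F = F}
  mul_mem' {F G} hF hG w := by rw [map_mul, hF w, hG w]
  add_mem' {F G} hF hG w := by rw [map_add, hF w, hG w]
  algebraMap_mem' r w := (weylAction H w).commutes r

end Weyl

end

end ChevalleyRestriction

/-!
An invariant polynomial is constant along the integral curves of `ad`. For root vectors these curves
realise the simple reflections on the Cartan subalgebra, so restrictions are `W`-invariant.

Restriction is injective: if a subrepresentation of `ℂ[L]` vanishes on `H`, so do all directional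
derivatives of its elements, since the action of a root vector of weight `α` agrees on `H` with `α`
times the derivative along it. By Taylor's formula the subrepresentation is zero.

For surjectivity, regard `ℂ[H]` as an extension of `I = ℂ[L]^L`. The power sums of the roots are
the restrictions of `trace (ad y ^ n)`, so by Newton's identities `∏ (X - α)` has coefficients in
`I`. As `I` is integrally closed and the roots generate `ℂ[H]`, Galois theory reduces the claim to
showing that every `W`-invariant `f` is fixed by the `I`-automorphisms of `ℂ[H]`. Such an
automorphism permutes the roots, hence is the pullback along a linear map `s`, and `f (s h) = f h`
has to be checked only for `h` in the coroot lattice. There both points are integral and `I` does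
not separate them. Moving the second one to the Weyl chamber of the first, a comparison of highest
weights in the representations generated by determinants of root vectors shows that the two
coincide.
-/

namespace ChevalleyRestriction

noncomputable section

open Module

section Trace

open Polynomial

variable {K V W : Type*} [Field K] [AddCommGroup V] [Module K V] [AddCommGroup W] [Module K W]
  {A : End K V} {B : End K W}

theorem trace_aeval_eq_of_trace_pow_eq
    (h : ∀ n : ℕ, LinearMap.trace K V (A ^ n) = LinearMap.trace K W (B ^ n)) (p : K[X]) :
    LinearMap.trace K V (aeval A p) = LinearMap.trace K W (aeval B p) := by
  induction p using Polynomial.induction_on' with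
  | add p q hp hq => simp only [map_add, hp, hq]
  | monomial n c => simp only [aeval_monomial, ← Algebra.smul_def, map_smul, h]

theorem hasEigenvalue_of_trace_pow_eq [CharZero K] [FiniteDimensional K V] [FiniteDimensional K W]
    (h : ∀ n : ℕ, LinearMap.trace K V (A ^ n) = LinearMap.trace K W (B ^ n)) {a : K}
    (ha : A.HasEigenvalue a) : B.HasEigenvalue a := by
  by_contra hB
  obtain ⟨q, hAq, hq⟩ :=
    A.charpoly.exists_eq_pow_rootMultiplicity_mul_and_not_dvd A.charpoly_monic.ne_zero a
  set N := A.charpoly.rootMultiplicity a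
  have hB' : ¬ X - C a ∣ B.charpoly := by
    rwa [dvd_iff_isRoot, ← End.hasEigenvalue_iff_isRoot_charpoly]
  have hN : N ≠ 0 := ((rootMultiplicity_pos A.charpoly_monic.ne_zero).2
    ((End.hasEigenvalue_iff_isRoot_charpoly A a).1 ha)).ne'
  obtain ⟨u, w, huw⟩ : IsCoprime ((X - C a) ^ N) (q * B.charpoly) :=
    ((irreducible_X_sub_C a).coprime_iff_not_dvd.2
      ((prime_X_sub_C a).not_dvd_mul hq hB')).pow_left
  -- `e = E(A)` is the projection to the generalized eigenspace, whereas `E(B) = 0`.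
  let E := w * (q * B.charpoly)
  have hE : E * E = E - w * u * B.charpoly * A.charpoly := by
    rw [hAq]
    linear_combination E * huw
  have hidem : IsIdempotentElem (aeval A E) := by
    rw [IsIdempotentElem, ← map_mul, hE, map_sub, map_mul (aeval A) _ A.charpoly,
      LinearMap.aeval_self_charpoly, mul_zero, sub_zero]
  have htrace : LinearMap.trace K V (aeval A E) = 0 := by
    rw [trace_aeval_eq_of_trace_pow_eq h, map_mul (aeval B), map_mul (aeval B),
      LinearMap.aeval_self_charpoly, mul_zero, mul_zero, map_zero]
  obtain ⟨v, hv⟩ := ha.exists_hasEigenvector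
  have hEa : E.eval a = 1 := by simpa [hN, E] using congrArg (eval a) huw
  refine hv.2 ?_
  rw [← one_smul K v, ← hEa, ← End.aeval_apply_of_hasEigenvector hv,
    LinearMap.IsIdempotentElem.eq_zero_of_trace_eq_zero hidem htrace, LinearMap.zero_apply]

end Trace

section Newton

variable {K B ι : Type*} [Field K] [CharZero K] [CommRing B] [Algebra K B] [Fintype ι]
  {R : Subalgebra K B} {a : ι → B}

open MvPolynomial in
theorem aeval_esymm_mem (h : ∀ n, n ≠ 0 → ∑ i, a i ^ n ∈ R) (k : ℕ) :
    aeval a (esymm ι K k) ∈ R := by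
  induction k using Nat.strong_induction_on with
  | _ k ih =>
    rcases eq_or_ne k 0 with rfl | hk
    · simp
    have hneg (n : ℕ) : (-1 : B) ^ n ∈ R := pow_mem (neg_mem (one_mem _)) n
    have hpsum (n : ℕ) (hn : n ≠ 0) : aeval a (psum ι K n) ∈ R := by
      simpa [psum] using h n hn
    have newton : (k : B) * aeval a (esymm ι K k) ∈ R := by
      rw [← map_natCast (aeval (R := K) a), ← map_mul, mul_esymm_eq_sum, map_mul, map_sum]
      simp only [map_mul, map_pow, map_neg, map_one]
      refine mul_mem (hneg _) (sum_mem fun p hp => ?_)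
      rw [Finset.mem_filter, Finset.HasAntidiagonal.mem_antidiagonal] at hp
      exact mul_mem (mul_mem (hneg _) (ih _ hp.2)) (hpsum _ (by omega))
    have hdiv : aeval a (esymm ι K k) = (k : K)⁻¹ • ((k : B) * aeval a (esymm ι K k)) := by
      rw [← map_natCast (algebraMap K B), ← Algebra.smul_def,
        inv_smul_smul₀ (Nat.cast_ne_zero.2 hk)]
    exact hdiv ▸ R.smul_mem newton _

open Polynomial in
theorem coeff_prod_X_sub_C_mem (h : ∀ n, n ≠ 0 → ∑ i, a i ^ n ∈ R) (k : ℕ) :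
    (∏ i, (X - C (a i))).coeff k ∈ R := by
  have hprod : ∏ i, (X - C (a i)) = ((Finset.univ.val.map a).map fun t => X - C t).prod := by
    rw [Multiset.map_map]
    rfl
  rcases le_or_gt k (Fintype.card ι) with hk | hk
  · rw [hprod, Multiset.prod_X_sub_C_coeff _ (by simpa using hk),
      ← MvPolynomial.aeval_esymm_eq_multiset_esymm ι K]
    exact mul_mem (pow_mem (neg_mem (one_mem _)) _) (aeval_esymm_mem h _)
  · rw [coeff_eq_zero_of_natDegree_lt]
    · exact zero_mem _
    · exact (natDegree_prod_le _ _).trans_lt <|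
        (Finset.sum_le_card_nsmul _ _ 1 fun i _ => natDegree_X_sub_C_le (a i)).trans_lt <| by
          simpa using hk

end Newton

section MatrixDerivation

open Matrix

variable {R A ι : Type*} [CommRing R] [CommRing A] [Algebra R A] (D : Derivation R A A)

theorem derivation_prod [DecidableEq ι] (s : Finset ι) (f : ι → A) :
    D (∏ i ∈ s, f i) = ∑ i ∈ s, ∏ k ∈ s, Function.update f i (D (f i)) k := by
  induction s using Finset.induction_on with
  | empty => simp
  | insert a s ha ih =>
    have hself : ∏ k ∈ s, Function.update f a (D (f a)) k = ∏ k ∈ s, f k :=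
      Finset.prod_update_of_notMem ha _ _
    have hother (i : ι) (hi : i ∈ s) : Function.update f i (D (f i)) a = f a :=
      Function.update_of_ne (ne_of_mem_of_not_mem hi ha).symm _ _
    simp only [Finset.prod_insert ha, Finset.sum_insert ha, D.leibniz, ih, smul_eq_mul,
      Function.update_self, hself, Finset.mul_sum]
    rw [add_comm, mul_comm]
    exact congrArg _ (Finset.sum_congr rfl fun i hi => by rw [hother i hi])

variable [Fintype ι]

theorem map_derivation_mul (M N : Matrix ι ι A) :
    (M * N).map D = M.map D * N + M * N.map D := by
  ext i j
  simp only [map_apply, mul_apply, Matrix.add_apply, map_sum, Derivation.leibniz, smul_eq_mul,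
    Finset.sum_add_distrib, mul_comm (N _ _), add_comm]

variable [DecidableEq ι]

theorem map_derivation_pow_of_map_eq_commutator {X Z : Matrix ι ι A}
    (h : X.map D = X * Z - Z * X) (n : ℕ) : (X ^ n).map D = X ^ n * Z - Z * X ^ n := by
  induction n with
  | zero =>
    ext i j
    rcases eq_or_ne i j with rfl | hij <;> simp [*]
  | succ n ih =>
    rw [pow_succ, map_derivation_mul, ih, h]
    noncomm_ring

theorem derivation_trace_pow_eq_zero {X Z : Matrix ι ι A} (h : X.map D = X * Z - Z * X) (n : ℕ) :
    D (trace (X ^ n)) = 0 := by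
  have htrace : D (trace (X ^ n)) = trace ((X ^ n).map D) := map_sum D _ _
  rw [htrace, map_derivation_pow_of_map_eq_commutator D h, trace_sub, trace_mul_comm, sub_self]

theorem derivation_det (M : Matrix ι ι A) :
    D M.det = ∑ i, (M.updateRow i fun j => D (M i j)).det := by
  simp_rw [← det_transpose M, ← det_transpose (updateRow _ _ _), det_apply, map_sum]
  rw [Finset.sum_comm]
  refine Finset.sum_congr rfl fun σ _ => ?_
  rw [Units.smul_def, map_zsmul, derivation_prod, Finset.smul_sum]
  refine Finset.sum_congr rfl fun i _ => ?_
  congr 1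
  refine Finset.prod_congr rfl fun k _ => ?_
  rcases eq_or_ne k i with rfl | hk
  · simp
  · simp [hk]

end MatrixDerivation

section LayerCake

theorem sum_toNat_mul_eq_zero {κ : Type*} [Fintype κ] {z w : κ → ℤ}
    (h : ∀ t : ℕ, ∑ α with (t : ℤ) < z α, w α = 0) : ∑ α, ((z α).toNat : ℤ) * w α = 0 := by
  let n := ∑ α, (z α).toNat
  have layers (α : κ) : ((z α).toNat : ℤ) * w α =
      ∑ t ∈ Finset.range n, if (t : ℤ) < z α then w α else 0 := by
    have hle : (z α).toNat ≤ n :=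
      Finset.single_le_sum (f := fun α => (z α).toNat) (fun _ _ => Nat.zero_le _)
        (Finset.mem_univ α)
    have hfilter : (Finset.range n).filter (fun t : ℕ => (t : ℤ) < z α) =
        Finset.range (z α).toNat := by
      ext t
      simp only [Finset.mem_filter, Finset.mem_range]
      omega
    rw [← Finset.sum_filter, Finset.sum_const, nsmul_eq_mul, hfilter, Finset.card_range]
  simp_rw [layers]
  rw [Finset.sum_comm]
  exact Finset.sum_eq_zero fun t _ => by rw [← Finset.sum_filter, h]

end LayerCake

section IntegralExtension

open Polynomial

variable {I A ι : Type*} [CommRing I] [CommRing A] [Algebra I A] [Fintype ι] {a : ι → A} {p : I[X]}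

theorem isIntegral_of_map_eq_prod [FaithfulSMul I A]
    (ha : Algebra.adjoin I (Set.range a) = ⊤)
    (hp : p.map (algebraMap I A) = ∏ i, (X - C (a i))) : Algebra.IsIntegral I A := by
  have hmonic : p.Monic := monic_of_injective (FaithfulSMul.algebraMap_injective I A)
    (hp ▸ monic_prod_X_sub_C a Finset.univ)
  have hroot (i : ι) : IsIntegral I (a i) := by
    refine ⟨p, hmonic, ?_⟩
    rw [eval₂_eq_eval_map, hp, eval_prod]
    exact Finset.prod_eq_zero (Finset.mem_univ i) (by simp)
  have : Algebra.IsIntegral I (Algebra.adjoin I (Set.range a)) :=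
    Algebra.IsIntegral.adjoin (Set.forall_mem_range.2 hroot)
  rw [ha] at this
  exact Algebra.IsIntegral.of_surjective Subalgebra.topEquiv.toAlgHom Subalgebra.topEquiv.surjective

variable (K L : Type*) [Field K] [Algebra I K] [Field L] [Algebra A L]
  [IsFractionRing A L] [Algebra K L] [Algebra I L] [IsScalarTower I K L] [IsScalarTower I A L]

theorem isSplittingField_of_map_eq_prod (ha : Algebra.adjoin I (Set.range a) = ⊤)
    (hp : p.map (algebraMap I A) = ∏ i, (X - C (a i))) :
    (p.map (algebraMap I K)).IsSplittingField K L := by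
  have hmap : (p.map (algebraMap I K)).map (algebraMap K L) =
      ∏ i, (X - C (algebraMap A L (a i))) := by
    rw [Polynomial.map_map, ← IsScalarTower.algebraMap_eq, IsScalarTower.algebraMap_eq I A L,
      ← Polynomial.map_map, hp, Polynomial.map_prod]
    simp
  have hroot (i : ι) : algebraMap A L (a i) ∈ (p.map (algebraMap I K)).rootSet L := by
    rw [mem_rootSet']
    rw [hmap, aeval_def, eval₂_eq_eval_map, hmap, eval_prod]
    exact ⟨(monic_prod_X_sub_C _ _).ne_zero,
      Finset.prod_eq_zero (Finset.mem_univ i) (by simp)⟩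
  rw [isSplittingField_iff_intermediateField, eq_top_iff]
  refine ⟨hmap ▸ Splits.prod fun i _ => Splits.X_sub_C _, fun q _ => ?_⟩
  let E := IntermediateField.adjoin K ((p.map (algebraMap I K)).rootSet L)
  have hmem (x : A) : algebraMap A L x ∈ E := by
    have hx : x ∈ Algebra.adjoin I (Set.range a) := ha ▸ Algebra.mem_top
    induction hx using Algebra.adjoin_induction with
    | mem x hx =>
      obtain ⟨i, rfl⟩ := hx
      exact IntermediateField.subset_adjoin _ _ (hroot i)
    | algebraMap r =>
      rw [← IsScalarTower.algebraMap_apply, IsScalarTower.algebraMap_apply I K L]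
      exact E.algebraMap_mem _
    | add x y _ _ h₁ h₂ => exact map_add (algebraMap A L) x y ▸ add_mem h₁ h₂
    | mul x y _ _ h₁ h₂ => exact map_mul (algebraMap A L) x y ▸ mul_mem h₁ h₂
  obtain ⟨x, y, -, rfl⟩ := IsFractionRing.div_surjective A q
  exact div_mem (hmem x) (hmem y)

variable [FaithfulSMul I A] [IsDomain I] [IsIntegrallyClosed I] [CharZero I] [IsDomain A]
  [IsIntegrallyClosed A]

theorem exists_algebraMap_eq_of_forall_algEquiv (ha : Algebra.adjoin I (Set.range a) = ⊤)
    (hp : p.map (algebraMap I A) = ∏ i, (X - C (a i))) {f : A} (hf : ∀ σ : A ≃ₐ[I] A, σ f = f) :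
    ∃ F : I, algebraMap I A F = f := by
  let K := FractionRing I
  let L := FractionRing A
  have : FaithfulSMul I L := inferInstance
  let : Algebra K L := FractionRing.liftAlgebra I L
  have : IsScalarTower I K L := FractionRing.isScalarTower_liftAlgebra I L
  have : CharZero K := charZero_of_injective_algebraMap (IsFractionRing.injective I K)
  have : (p.map (algebraMap I K)).IsSplittingField K L := isSplittingField_of_map_eq_prod K L ha hp
  have : Normal K L := Normal.of_isSplittingField (p.map (algebraMap I K))
  have : IsGalois K L := ⟨⟩
  have : FiniteDimensional K L := IsSplittingField.finiteDimensional L (p.map (algebraMap I K))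
  have : Algebra.IsIntegral I A := isIntegral_of_map_eq_prod ha hp
  have : IsIntegralClosure A I L := IsIntegralClosure.of_isIntegrallyClosed A I L
  exact (Algebra.isInvariant_of_isGalois' I K L A).isInvariant f hf

end IntegralExtension

section Endomorphisms

open Polynomial

variable {A ι : Type*} [CommRing A] [IsDomain A] [Fintype ι] {a : ι → A}

theorem exists_apply_eq_of_map_eq_prod {R : Type*} [CommRing R] [Algebra R A] {p : R[X]}
    (hp : p.map (algebraMap R A) = ∏ i, (X - C (a i))) (σ : A →ₐ[R] A) (i : ι) :
    ∃ j, σ (a i) = a j := by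
  have haeval (x : A) : aeval x p = ∏ j, (x - a j) := by
    rw [aeval_def, eval₂_eq_eval_map, hp, eval_prod]
    simp only [eval_sub, eval_X, eval_C]
  have hroot : aeval (σ (a i)) p = 0 := by
    rw [aeval_algHom_apply, haeval, Finset.prod_eq_zero (Finset.mem_univ i) (sub_self _), map_zero]
  rw [haeval] at hroot
  obtain ⟨j, -, hj⟩ := Finset.prod_eq_zero_iff.1 hroot
  exact ⟨j, sub_eq_zero.1 hj⟩

theorem mem_map_of_forall_algHom {K B : Type*} [Field K] [CharZero K] [CommRing B] [IsDomain B]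
    [Algebra K B] [Algebra K A] [IsIntegrallyClosed A] {S : Subalgebra K B} [IsIntegrallyClosed S]
    {φ : B →ₐ[K] A} (hφ : Set.InjOn φ S) (ha : Algebra.adjoin K (Set.range a) = ⊤)
    (hS : ∀ n, (∏ i, (X - C (a i))).coeff n ∈ S.map φ) {f : A}
    (hf : ∀ σ : A →ₐ[K] A, (∀ b ∈ S, σ (φ b) = φ b) → (∀ i, ∃ j, σ (a i) = a j) → σ f = f) :
    f ∈ S.map φ := by
  let : Algebra S A := (φ.comp S.val).toRingHom.toAlgebra
  have : IsScalarTower K S A := IsScalarTower.of_algebraMap_eq fun r => (φ.commutes r).symm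
  have : FaithfulSMul S A :=
    (faithfulSMul_iff_algebraMap_injective S A).2 (Set.injOn_iff_injective.1 hφ)
  have : CharZero S := charZero_of_injective_algebraMap (algebraMap K S).injective
  have hgen : Algebra.adjoin S (Set.range a) = ⊤ := by
    have hle : Algebra.adjoin K (Set.range a) ≤
        (Algebra.adjoin S (Set.range a)).restrictScalars K :=
      Algebra.adjoin_le Algebra.subset_adjoin
    exact Algebra.eq_top_iff.2 fun x => hle (ha ▸ Algebra.mem_top)
  obtain ⟨p, hp⟩ : ∃ p : S[X], p.map (algebraMap S A) = ∏ i, (X - C (a i)) := by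
    refine (mem_lifts _).1 ((lifts_iff_coeff_lifts _).2 fun n => ?_)
    obtain ⟨b, hb, hbn⟩ := hS n
    exact ⟨⟨b, hb⟩, hbn⟩
  obtain ⟨b, hb⟩ := exists_algebraMap_eq_of_forall_algEquiv hgen hp fun σ =>
    hf (σ.toAlgHom.restrictScalars K) (fun b hb => σ.commutes ⟨b, hb⟩)
      (exists_apply_eq_of_map_eq_prod hp σ.toAlgHom)
  exact ⟨b, b.2, hb⟩

end Endomorphisms

theorem isIntegrallyClosed_of_saturated {R B : Type*} [CommRing R] [CommRing B] [IsDomain B]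
    [IsIntegrallyClosed B] [Algebra R B] (S : Subalgebra R B)
    (hS : ∀ s ∈ S, s ≠ 0 → ∀ b, s * b ∈ S → b ∈ S) : IsIntegrallyClosed S := by
  rw [isIntegrallyClosed_iff (FractionRing S)]
  intro x hx
  let K := FractionRing S
  let L := FractionRing B
  let : Algebra K L := FractionRing.liftAlgebra S L
  have : IsScalarTower S K L := FractionRing.isScalarTower_liftAlgebra S L
  have hxL : IsIntegral B (algebraMap K L x) := (hx.algebraMap (B := L)).tower_top
  obtain ⟨b, hb⟩ := IsIntegrallyClosed.isIntegral_iff.1 hxL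
  obtain ⟨r, s, hs, rfl⟩ := IsFractionRing.div_surjective S x
  have hs0 : s ≠ 0 := nonZeroDivisors.ne_zero hs
  have hrs : (s : B) * b = r := by
    refine IsFractionRing.injective B L ?_
    have hsL : algebraMap B L s ≠ 0 := by simpa using hs0
    rw [map_mul, hb, map_div₀, ← IsScalarTower.algebraMap_apply, ← IsScalarTower.algebraMap_apply]
    exact mul_div_cancel₀ _ hsL
  have hbS : b ∈ S := hS s s.2 (by simpa using hs0) b (hrs ▸ r.2)
  refine ⟨⟨b, hbS⟩, ?_⟩
  rw [eq_div_iff (by simpa using hs0), ← map_mul, mul_comm]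
  exact congrArg _ (Subtype.ext hrs)

section HomogeneousSubalgebra

variable {R B ι : Type*} [CommRing R] [Ring B] [Algebra R B]

theorem iSupIndep_comap_of_injective {M N : Type*} [AddCommGroup M] [Module R M] [AddCommGroup N]
    [Module R N] {f : M →ₗ[R] N} (hf : Function.Injective f) {p : ι → Submodule R N}
    (hp : iSupIndep p) : iSupIndep fun i => (p i).comap f := by
  refine fun i => Submodule.disjoint_def.2 fun x hi hx => hf ?_
  have hle : (⨆ j, ⨆ _ : j ≠ i, (p j).comap f) ≤ (⨆ j, ⨆ _ : j ≠ i, p j).comap f :=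
    iSup₂_le fun j hj => Submodule.comap_mono (le_iSup₂ (f := fun j _ => p j) j hj)
  rw [map_zero]
  exact Submodule.disjoint_def.1 (hp i) _ hi (hle hx)

variable [DecidableEq ι] [AddMonoid ι] (𝒜 : ι → Submodule R B) [GradedAlgebra 𝒜]

theorem nonempty_gradedAlgebra_comap_val (S : Subalgebra R B)
    (hS : DirectSum.SetLike.IsHomogeneous 𝒜 S) :
    Nonempty (GradedAlgebra fun i => (𝒜 i).comap S.val.toLinearMap) := by
  have hmonoid : SetLike.GradedMonoid fun i => (𝒜 i).comap S.val.toLinearMap :=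
    { one_mem := SetLike.GradedOne.one_mem (A := 𝒜)
      mul_mem := fun _ _ _ _ ha hb => SetLike.GradedMul.mul_mem (A := 𝒜) ha hb }
  classical
  have hsup : ⨆ i, (𝒜 i).comap S.val.toLinearMap = ⊤ := by
    refine eq_top_iff.2 fun b _ => ?_
    have hb : b = ∑ i ∈ (DirectSum.decompose 𝒜 (b : B)).support,
        ⟨DirectSum.decompose 𝒜 (b : B) i, hS i b.2⟩ := by
      refine Subtype.ext ?_
      rw [AddSubmonoidClass.coe_finsetSum]
      exact (DirectSum.sum_support_decompose 𝒜 (b : B)).symm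
    rw [hb]
    exact sum_mem fun i _ => Submodule.mem_iSup_of_mem i
      (SetLike.coe_mem (DirectSum.decompose 𝒜 (b : B) i))
  have hindep := iSupIndep_comap_of_injective (f := S.val.toLinearMap) Subtype.val_injective
    (DirectSum.Decomposition.isInternal 𝒜).submodule_iSupIndep
  exact ⟨{ hmonoid, (DirectSum.isInternal_submodule_of_iSupIndep_of_iSup_eq_top
    hindep hsup).chooseDecomposition with }⟩

end HomogeneousSubalgebra

section Graded

theorem map_decompose {R M N ι : Type*} [DecidableEq ι] [Semiring R] [AddCommMonoid M] [Module R M]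
    [AddCommMonoid N] [Module R N] (ℳ : ι → Submodule R M) [DirectSum.Decomposition ℳ]
    (𝒩 : ι → Submodule R N) [DirectSum.Decomposition 𝒩] {f : M →ₗ[R] N}
    (hf : ∀ i, ∀ x ∈ ℳ i, f x ∈ 𝒩 i) (x : M) (i : ι) :
    f (DirectSum.decompose ℳ x i) = DirectSum.decompose 𝒩 (f x) i := by
  induction x using DirectSum.Decomposition.inductionOn ℳ with
  | zero => simp
  | @homogeneous j m =>
    rcases eq_or_ne j i with rfl | hij
    · rw [DirectSum.decompose_coe, DirectSum.of_eq_same,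
        DirectSum.decompose_of_mem_same 𝒩 (hf j m m.2)]
    · rw [DirectSum.decompose_of_mem_ne ℳ m.2 hij, map_zero,
        DirectSum.decompose_of_mem_ne 𝒩 (hf j m m.2) hij]
  | add x y hx hy => simp [hx, hy]

end Graded

section PolyFun

variable {V U ι : Type*} [AddCommGroup V] [Module ℂ V] [AddCommGroup U] [Module ℂ U]

@[simp]
theorem linearPart_apply (l : Dual ℂ V) (y : V) : (linearPart V l : V → ℂ) y = l y := rfl

theorem pullback_linearPart (f : U →ₗ[ℂ] V) (l : Dual ℂ V) :
    pullback f (linearPart V l) = linearPart U (l ∘ₗ f) := rfl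

@[ext]
theorem PolyFun.ext {F G : PolyFun V} (h : ∀ y, (F : V → ℂ) y = (G : V → ℂ) y) : F = G :=
  Subtype.ext (funext h)

/-- Evaluation of polynomial functions at a point. -/
def evalAt (y : V) : PolyFun V →ₐ[ℂ] ℂ :=
  (Pi.evalAlgHom ℂ (fun _ : V => ℂ) y).comp (PolyFun V).val

theorem evalAt_apply (y : V) (F : PolyFun V) : evalAt y F = (F : V → ℂ) y := rfl

@[simp]
theorem PolyFun.sum_apply (s : Finset ι) (F : ι → PolyFun V) (y : V) :
    ((∑ i ∈ s, F i : PolyFun V) : V → ℂ) y = ∑ i ∈ s, (F i : V → ℂ) y :=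
  map_sum (evalAt y) F s

@[elab_as_elim]
theorem PolyFun.induction {P : PolyFun V → Prop} (linear : ∀ l, P (linearPart V l))
    (const : ∀ r, P (algebraMap ℂ _ r)) (add : ∀ F G, P F → P G → P (F + G))
    (mul : ∀ F G, P F → P G → P (F * G)) (F : PolyFun V) : P F := by
  obtain ⟨F, hF⟩ := F
  induction hF using Algebra.adjoin_induction with
  | mem F hF =>
    obtain ⟨l, rfl⟩ := hF
    exact linear l
  | algebraMap r => exact const r
  | add F G hF hG h₁ h₂ => exact add _ _ h₁ h₂
  | mul F G hF hG h₁ h₂ => exact mul _ _ h₁ h₂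

theorem adjoin_range_linearPart : Algebra.adjoin ℂ (Set.range (linearPart V)) = ⊤ := by
  rw [eq_top_iff]
  rintro F -
  induction F using PolyFun.induction with
  | linear l => exact Algebra.subset_adjoin ⟨l, rfl⟩
  | const r => exact Subalgebra.algebraMap_mem _ r
  | add F G h₁ h₂ => exact add_mem h₁ h₂
  | mul F G h₁ h₂ => exact mul_mem h₁ h₂

theorem adjoin_linearPart_of_span_eq_top {l : ι → Dual ℂ V}
    (hl : Submodule.span ℂ (Set.range l) = ⊤) :
    Algebra.adjoin ℂ (Set.range fun i => linearPart V (l i)) = ⊤ := by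
  rw [eq_top_iff, ← adjoin_range_linearPart, Algebra.adjoin_le_iff, ← LinearMap.coe_range,
    ← Submodule.map_top, ← hl, Submodule.map_span, ← Set.range_comp]
  exact Algebra.span_le_adjoin ℂ _

theorem aeval_linearPart_apply (l : ι → Dual ℂ V) (p : MvPolynomial ι ℂ) (y : V) :
    (MvPolynomial.aeval (fun i => linearPart V (l i)) p : PolyFun V).1 y =
      MvPolynomial.eval (fun i => l i y) p := by
  rw [← evalAt_apply, MvPolynomial.comp_aeval_apply]
  rfl

/-- The polynomial functions on `V` are the polynomials in the coordinates of a basis. -/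
def mvPolynomialEquiv [Finite ι] (b : Basis ι ℂ V) : MvPolynomial ι ℂ ≃ₐ[ℂ] PolyFun V :=
  AlgEquiv.ofBijective (MvPolynomial.aeval fun i => linearPart V (b.coord i)) <| by
    classical
    have := Fintype.ofFinite ι
    constructor
    · intro p q h
      refine MvPolynomial.funext fun x => ?_
      have hx : (fun i => b.coord i (b.equivFun.symm x)) = x := b.equivFun.apply_symm_apply x
      rw [← hx, ← aeval_linearPart_apply, ← aeval_linearPart_apply]
      exact congrArg (fun F : PolyFun V => F.1 (b.equivFun.symm x)) h
    · rw [← AlgHom.range_eq_top, ← Algebra.adjoin_range_eq_range_aeval]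
      refine adjoin_linearPart_of_span_eq_top ?_
      rw [← b.coe_dualBasis]
      exact b.dualBasis.span_eq

instance [FiniteDimensional ℂ V] : IsDomain (PolyFun V) :=
  (mvPolynomialEquiv (finBasis ℂ V)).symm.toMulEquiv.isDomain _

instance [FiniteDimensional ℂ V] : IsIntegrallyClosed (PolyFun V) :=
  IsIntegrallyClosed.of_equiv (mvPolynomialEquiv (finBasis ℂ V)).toRingEquiv

theorem linearPart_injective : Function.Injective (linearPart V) := fun _ _ h =>
  LinearMap.ext fun y => congrArg (fun F : PolyFun V => (F : V → ℂ) y) h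

theorem exists_eq_pullback [FiniteDimensional ℂ V] {σ : PolyFun V →ₐ[ℂ] PolyFun V}
    (hσ : ∀ l, σ (linearPart V l) ∈ LinearMap.range (linearPart V)) :
    ∃ s : End ℂ V, σ = pullback s := by
  let e := LinearEquiv.ofInjective (linearPart V) linearPart_injective
  let τ : End ℂ (Dual ℂ V) :=
    e.symm.toLinearMap ∘ₗ (σ.toLinearMap ∘ₗ linearPart V).codRestrict _ hσ
  have hτ (l : Dual ℂ V) : linearPart V (τ l) = σ (linearPart V l) :=
    congrArg Subtype.val (e.apply_symm_apply ⟨σ (linearPart V l), hσ l⟩)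
  let s : End ℂ V := (evalEquiv ℂ V).symm.toLinearMap ∘ₗ τ.dualMap ∘ₗ (evalEquiv ℂ V).toLinearMap
  have hs (l : Dual ℂ V) (x : V) : l (s x) = τ l x := by simp [s]
  refine ⟨s, AlgHom.ext_of_adjoin_eq_top adjoin_range_linearPart ?_⟩
  rintro _ ⟨l, rfl⟩
  rw [← hτ]
  exact PolyFun.ext fun x => (hs l x).symm

end PolyFun

section Derivative

variable {V : Type*} [AddCommGroup V] [Module ℂ V]

/-- The chain rule, along a curve that is only assumed to be differentiable coordinatewise since
`V` carries no topology. -/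
theorem hasDerivAt_comp_curve (F : PolyFun V) {c : ℂ → V} {v : V} {t : ℂ}
    (hc : ∀ l : Dual ℂ V, HasDerivAt (fun s => l (c s)) (l v) t) :
    HasDerivAt (fun s => (F : V → ℂ) (c s)) (lineDeriv ℂ (F : V → ℂ) (c t) v) t := by
  induction F using PolyFun.induction with
  | linear l => exact (lineDeriv_linear l (c t) v).symm ▸ hc l
  | const r =>
    have hr : lineDeriv ℂ (algebraMap ℂ (PolyFun V) r : V → ℂ) (c t) v = 0 := deriv_const (0 : ℂ) r
    exact hr ▸ hasDerivAt_const t r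
  | add F G h₁ h₂ => exact (lineDeriv_add F.2 G.2 (c t) v).symm ▸ h₁.add h₂
  | mul F G h₁ h₂ =>
    have hFG : lineDeriv ℂ (F * G : PolyFun V).1 (c t) v = _ := lineDeriv_mul F.2 G.2 (c t) v
    rw [hFG, add_comm, mul_comm (G.1 _)]
    exact h₁.mul h₂

theorem lineDeriv_const_mem (v : V) {F : V → ℂ} (hF : F ∈ PolyFun V) :
    (fun y => lineDeriv ℂ F y v) ∈ PolyFun V := by
  induction hF using Algebra.adjoin_induction with
  | mem F hF =>
    obtain ⟨l, rfl⟩ := hF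
    simp only [lineDeriv_linear]
    exact (PolyFun V).algebraMap_mem (l v)
  | algebraMap r =>
    have hr : (fun y => lineDeriv ℂ (algebraMap ℂ (V → ℂ) r) y v) = 0 :=
      funext fun _ => deriv_const (0 : ℂ) r
    exact hr ▸ (PolyFun V).zero_mem
  | add F G hF hG h₁ h₂ =>
    simp only [lineDeriv_add hF hG]
    exact add_mem h₁ h₂
  | mul F G hF hG h₁ h₂ =>
    simp only [lineDeriv_mul hF hG]
    exact add_mem (mul_mem hF h₂) (mul_mem hG h₁)

variable (V) in
/-- The derivative of polynomial functions in the direction of a constant vector. -/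
def dirDeriv : V →ₗ[ℂ] Derivation ℂ (PolyFun V) (PolyFun V) where
  toFun v := Derivation.mk'
    { toFun := fun F => ⟨fun y => lineDeriv ℂ (F : V → ℂ) y v, lineDeriv_const_mem v F.2⟩
      map_add' := fun F G => PolyFun.ext fun y => lineDeriv_add F.2 G.2 y v
      map_smul' := fun c F => PolyFun.ext fun y =>
        deriv_const_smul c (lineDifferentiableAt F.2 y v) }
    fun F G => PolyFun.ext fun y => lineDeriv_mul F.2 G.2 y v
  map_add' v w := derivation_ext fun l => PolyFun.ext fun y => by
    change lineDeriv ℂ (l : V → ℂ) y (v + w) =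
      lineDeriv ℂ (l : V → ℂ) y v + lineDeriv ℂ (l : V → ℂ) y w
    simp only [lineDeriv_linear, map_add]
  map_smul' c v := derivation_ext fun l => PolyFun.ext fun y => by
    change lineDeriv ℂ (l : V → ℂ) y (c • v) = c * lineDeriv ℂ (l : V → ℂ) y v
    simp only [lineDeriv_linear, map_smul, smul_eq_mul]

theorem dirDeriv_linearPart (v : V) (l : Dual ℂ V) :
    dirDeriv V v (linearPart V l) = algebraMap ℂ _ (l v) :=
  PolyFun.ext fun y => lineDeriv_linear l y v

end Derivative

section Lines

open Polynomial

variable {V : Type*} [AddCommGroup V] [Module ℂ V]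

theorem exists_polynomial_line (F : PolyFun V) (x v : V) :
    ∃ p : ℂ[X], ∀ t : ℂ, (F : V → ℂ) (x + t • v) = p.eval t := by
  induction F using PolyFun.induction with
  | linear l => exact ⟨C (l x) + C (l v) * X, fun t => by simp [mul_comm (l v)]⟩
  | const r => exact ⟨C r, fun t => by rw [eval_C]; rfl⟩
  | add F G h₁ h₂ =>
    obtain ⟨p, hp⟩ := h₁
    obtain ⟨q, hq⟩ := h₂
    exact ⟨p + q, fun t => by rw [eval_add, ← hp, ← hq]; rfl⟩
  | mul F G h₁ h₂ =>
    obtain ⟨p, hp⟩ := h₁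
    obtain ⟨q, hq⟩ := h₂
    exact ⟨p * q, fun t => by rw [eval_mul, ← hp, ← hq]; rfl⟩

theorem dirDeriv_iterate_line {F : PolyFun V} {p : ℂ[X]} {x v : V}
    (hp : ∀ t : ℂ, (F : V → ℂ) (x + t • v) = p.eval t) (k : ℕ) (t : ℂ) :
    ((dirDeriv V v)^[k] F : V → ℂ) (x + t • v) = (derivative^[k] p).eval t := by
  induction k generalizing F p with
  | zero => exact hp t
  | succ k ih =>
    rw [Function.iterate_succ_apply, Function.iterate_succ_apply]
    refine ih fun t => ?_
    have hderiv : HasDerivAt (fun s : ℂ => (F : V → ℂ) (x + s • v))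
        (lineDeriv ℂ (F : V → ℂ) (x + t • v) v) t := hasDerivAt_comp_curve F fun l => by
      simpa using ((hasDerivAt_id t).mul_const (l v)).const_add (l x)
    simp only [hp] at hderiv
    exact hderiv.unique (p.hasDerivAt t)

/-- Taylor's formula at the origin. -/
theorem eq_zero_of_dirDeriv_iterate_eq_zero {F : PolyFun V}
    (h : ∀ v k, ((dirDeriv V v)^[k] F : V → ℂ) 0 = 0) : F = 0 := by
  ext v
  obtain ⟨p, hp⟩ := exists_polynomial_line F 0 v
  have hp0 : p = 0 := by
    ext k
    have hk := dirDeriv_iterate_line hp k 0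
    rw [zero_smul, add_zero, h, ← coeff_zero_eq_eval_zero, coeff_iterate_derivative] at hk
    simpa [Nat.descFactorial_self, Nat.factorial_ne_zero] using hk.symm
  simpa [hp0] using hp 1

theorem eq_zero_on_line_of_forall_int {F : PolyFun V} {x v : V}
    (h : ∀ n : ℤ, (F : V → ℂ) (x + n • v) = 0) (c : ℂ) : (F : V → ℂ) (x + c • v) = 0 := by
  obtain ⟨p, hp⟩ := exists_polynomial_line F x v
  have hp0 : p = 0 := by
    refine eq_zero_of_infinite_isRoot p
      ((Set.infinite_range_of_injective (Int.cast_injective (α := ℂ))).mono ?_)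
    rintro _ ⟨n, rfl⟩
    rw [Set.mem_ofPred_eq, IsRoot.def, ← hp, Int.cast_smul_eq_zsmul, h]
  rw [hp, hp0, eval_zero]

theorem eq_zero_of_forall_mem_addSubgroup {F : PolyFun V} {S : Set V}
    (hS : Submodule.span ℂ S = ⊤) (h : ∀ x ∈ AddSubgroup.closure S, (F : V → ℂ) x = 0) :
    F = 0 := by
  have translate (u : V) (hu : u ∈ Submodule.span ℂ S) (c : ℂ) (x : V)
      (hx : ∀ y ∈ AddSubgroup.closure S, (F : V → ℂ) (x + y) = 0) :
      ∀ y ∈ AddSubgroup.closure S, (F : V → ℂ) (x + c • u + y) = 0 := by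
    induction hu using Submodule.span_induction generalizing c x with
    | mem u hu =>
      intro y hy
      rw [add_right_comm]
      refine eq_zero_on_line_of_forall_int (fun n => ?_) c
      rw [add_assoc]
      exact hx _ (add_mem hy (zsmul_mem (AddSubgroup.subset_closure hu) n))
    | zero => simpa using hx
    | add u w _ _ h₁ h₂ => simpa only [smul_add, add_assoc] using h₂ c _ (h₁ c x hx)
    | smul a u _ h => simpa only [smul_smul] using h (c * a) x hx
  ext v
  simpa using translate v (hS ▸ Submodule.mem_top) 1 0 (fun y hy => by simpa using h y hy) 0
    (zero_mem _)

end Lines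

section Grading

variable {V U : Type*} [AddCommGroup V] [Module ℂ V] [AddCommGroup U] [Module ℂ U]

theorem linearPart_mem_homogeneous (l : Dual ℂ V) : linearPart V l ∈ homogeneous V 1 := by
  rw [homogeneous, pow_one]
  exact ⟨l, rfl⟩

instance : SetLike.GradedMonoid (homogeneous V) := Submodule.nat_power_gradedMonoid _

theorem pullback_mem_homogeneous (f : U →ₗ[ℂ] V) (n : ℕ) :
    ∀ F ∈ homogeneous V n, pullback f F ∈ homogeneous U n := by
  suffices (homogeneous V n).map (pullback f).toLinearMap ≤ homogeneous U n from
    Submodule.map_le_iff_le_comap.1 this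
  rw [homogeneous, homogeneous, Submodule.map_pow]
  refine pow_le_pow_left' ?_ n
  rintro _ ⟨_, ⟨l, rfl⟩, rfl⟩
  exact ⟨l ∘ₗ f, rfl⟩

theorem vectorField_mem_homogeneous (A : End ℂ V) {n : ℕ} {F : PolyFun V}
    (hF : F ∈ homogeneous V n) : vectorField A F ∈ homogeneous V n := by
  induction hF using Submodule.pow_induction_on_right' with
  | algebraMap r =>
    rw [Derivation.map_algebraMap]
    exact zero_mem _
  | add F G n _ _ h₁ h₂ =>
    rw [map_add]
    exact add_mem h₁ h₂
  | mul_mem n F hF h l hl =>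
    obtain ⟨l, rfl⟩ := hl
    rw [Derivation.leibniz, vectorField_linear, smul_eq_mul, smul_eq_mul, mul_comm (linearPart V l)]
    exact add_mem (Submodule.mul_mem_mul hF ⟨_, rfl⟩) (Submodule.mul_mem_mul h ⟨_, rfl⟩)

theorem pullback_smul_id_of_mem_homogeneous (c : ℂ) {n : ℕ} {F : PolyFun V}
    (hF : F ∈ homogeneous V n) : pullback (c • LinearMap.id) F = c ^ n • F := by
  induction hF using Submodule.pow_induction_on_right' with
  | algebraMap r => rw [AlgHom.commutes, pow_zero, one_smul]
  | add F G n _ _ h₁ h₂ => rw [map_add, h₁, h₂, smul_add]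
  | mul_mem n F _ h l hl =>
    obtain ⟨l, rfl⟩ := hl
    rw [map_mul, h, pullback_linearPart, LinearMap.comp_smul, LinearMap.comp_id, map_smul,
      smul_mul_smul_comm, pow_succ]

theorem iSupIndep_homogeneous : iSupIndep (homogeneous V) := by
  have two_pow_injective : Function.Injective fun n : ℕ => (2 : ℂ) ^ n := fun m n h =>
    Nat.pow_right_injective le_rfl <| by
      dsimp only at h ⊢
      exact_mod_cast h
  refine ((End.eigenspaces_iSupIndep (pullback ((2 : ℂ) • LinearMap.id) :
    PolyFun V →ₐ[ℂ] PolyFun V).toLinearMap).comp two_pow_injective).mono fun n F hF => ?_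
  exact End.mem_eigenspace_iff.2 (pullback_smul_id_of_mem_homogeneous 2 hF)

theorem iSup_homogeneous : ⨆ n, homogeneous V n = ⊤ := by
  rw [eq_top_iff]
  rintro F -
  induction F using PolyFun.induction with
  | linear l => exact Submodule.mem_iSup_of_mem 1 (linearPart_mem_homogeneous l)
  | const r =>
    refine Submodule.mem_iSup_of_mem 0 ?_
    rw [homogeneous, pow_zero]
    exact Submodule.algebraMap_mem r
  | add F G h₁ h₂ => exact add_mem h₁ h₂
  | mul F G h₁ h₂ =>
    have hmul : (⨆ n, homogeneous V n) * ⨆ n, homogeneous V n ≤ ⨆ n, homogeneous V n := by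
      simp only [Submodule.iSup_mul, Submodule.mul_iSup, iSup_le_iff]
      intro m n
      rw [homogeneous, homogeneous, ← pow_add]
      exact le_iSup (homogeneous V) (n + m)
    exact hmul (Submodule.mul_mem_mul h₁ h₂)

instance : GradedAlgebra (homogeneous V) :=
  { (inferInstance : SetLike.GradedMonoid (homogeneous V)),
    (DirectSum.isInternal_submodule_of_iSupIndep_of_iSup_eq_top iSupIndep_homogeneous
      iSup_homogeneous).chooseDecomposition with }

theorem finiteDimensional_homogeneous [FiniteDimensional ℂ V] (n : ℕ) :
    FiniteDimensional ℂ (homogeneous V n) :=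
  Module.Finite.iff_fg.2 (Submodule.FG.pow (Module.Finite.iff_fg.1 inferInstance) n)

theorem isHomogeneous_adjointInvariants (L : Type*) [LieRing L] [LieAlgebra ℂ L] :
    DirectSum.SetLike.IsHomogeneous (homogeneous L) (adjointInvariants L) := fun n F hF x => by
  have h := map_decompose (homogeneous L) (homogeneous L)
    (f := (adjointAction L x).toLinearMap) (fun _ _ => vectorField_mem_homogeneous _) F n
  rw [Derivation.coeFn_coe, hF x, DirectSum.decompose_zero] at h
  exact h

theorem isHomogeneous_weylInvariants {L : Type*} [LieRing L] [LieAlgebra ℂ L]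
    [FiniteDimensional ℂ L] [LieAlgebra.IsSemisimple ℂ L] (H : LieSubalgebra ℂ L)
    [H.IsCartanSubalgebra] :
    DirectSum.SetLike.IsHomogeneous (homogeneous H) (weylInvariants H) := fun n F hF w => by
  have h := map_decompose (homogeneous H) (homogeneous H)
    (f := (weylAction H w).toLinearMap) (pullback_mem_homogeneous _) F n
  refine h.trans ?_
  rw [AlgHom.toLinearMap_apply, hF w]

end Grading

section Representation

open LieModule

variable {V : Type*} [AddCommGroup V] [Module ℂ V]

theorem vectorField_add (A B : End ℂ V) : vectorField (A + B) = vectorField A + vectorField B :=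
  derivation_ext fun l => by
    simp only [Derivation.add_apply, vectorField_linear, LinearMap.comp_add, map_add]

theorem vectorField_smul (c : ℂ) (A : End ℂ V) : vectorField (c • A) = c • vectorField A :=
  derivation_ext fun l => by
    simp only [Derivation.smul_apply, vectorField_linear, LinearMap.comp_smul, map_smul]

theorem vectorField_commutator (A B : End ℂ V) :
    vectorField (B * A - A * B) = ⁅vectorField A, vectorField B⁆ :=
  derivation_ext fun l => by
    simp only [Derivation.commutator_apply, vectorField_linear, ← map_sub]
    congr 1
    ext y
    simp

variable {L ι : Type*} [LieRing L] [LieAlgebra ℂ L] [LieRingModule L V] [LieModule ℂ L V]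

/-- The action of `L` on `ℂ[V]` induced by an action on `V`:
`⁅x, F⁆ y = d/dt F(y - t ⁅x, y⁆)` at `t = 0`. For `V = L` it is `adjointAction L`. -/
instance : LieRingModule L (PolyFun V) where
  bracket x F := vectorField (-toEnd ℂ L V x) F
  add_lie x y F := by
    rw [map_add, neg_add, vectorField_add, Derivation.add_apply]
  lie_add x F G := map_add _ F G
  leibniz_lie x y F := by
    have h : -toEnd ℂ L V ⁅x, y⁆ = -toEnd ℂ L V y * -toEnd ℂ L V x -
        -toEnd ℂ L V x * -toEnd ℂ L V y := by
      ext v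
      simp
    rw [h, vectorField_commutator, Derivation.commutator_apply, sub_add_cancel]

theorem lie_polyFun (x : L) (F : PolyFun V) : ⁅x, F⁆ = vectorField (-toEnd ℂ L V x) F := rfl

instance : LieModule ℂ L (PolyFun V) where
  smul_lie c x F := by
    rw [lie_polyFun, map_smul, ← smul_neg, vectorField_smul]
    rfl
  lie_smul c x F := Derivation.map_smul _ c F

/-- The diagonal action of `L` on `V ^ ι`. -/
instance : LieRingModule L (ι → V) where
  bracket x v i := ⁅x, v i⁆
  add_lie _ _ _ := funext fun _ => add_lie _ _ _
  lie_add _ _ _ := funext fun _ => lie_add _ _ _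
  leibniz_lie _ _ _ := funext fun _ => leibniz_lie _ _ _

instance : LieModule ℂ L (ι → V) where
  smul_lie _ _ _ := funext fun _ => smul_lie _ _ _
  lie_smul _ _ _ := funext fun _ => lie_smul _ _ _

end Representation

section Invariance

variable {V : Type*} [AddCommGroup V] [Module ℂ V]

theorem apply_eq_of_integral_curve {A : End ℂ V} {F : PolyFun V} (hF : vectorField A F = 0)
    {c : ℂ → V} (hc : ∀ (l : Dual ℂ V) t, HasDerivAt (fun s => l (c s)) (l (A (c t))) t)
    (s t : ℂ) : (F : V → ℂ) (c s) = (F : V → ℂ) (c t) := by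
  have h (t : ℂ) : HasDerivAt (fun s => (F : V → ℂ) (c s)) 0 t := by
    have := hasDerivAt_comp_curve F fun l => hc l t
    rwa [← vectorField_apply, hF] at this
  exact is_const_of_deriv_eq_zero (fun t => (h t).differentiableAt) (fun t => (h t).deriv) s t

theorem apply_quadratic_curve {A : End ℂ V} {F : PolyFun V} (hF : vectorField A F = 0)
    {u₀ u₁ u₂ : V} (h₀ : A u₀ = u₁) (h₁ : A u₁ = (2 : ℂ) • u₂) (h₂ : A u₂ = 0) :
    (F : V → ℂ) (u₀ + u₁ + u₂) = (F : V → ℂ) u₀ := by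
  have hc (l : Dual ℂ V) (t : ℂ) : HasDerivAt (fun s : ℂ => l (u₀ + s • u₁ + s ^ 2 • u₂))
      (l (A (u₀ + t • u₁ + t ^ 2 • u₂))) t := by
    have h := (((hasDerivAt_id t).mul_const (l u₁)).const_add (l u₀)).add
      ((hasDerivAt_pow 2 t).mul_const (l u₂))
    simp only [map_add, map_smul, smul_eq_mul, h₀, h₁, h₂, map_zero, mul_zero, add_zero]
    exact h.congr_deriv (by simp; ring)
  simpa using apply_eq_of_integral_curve hF hc 1 0

end Invariance

section Restriction

open LieAlgebra LieAlgebra.IsKilling LieModule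

variable {L : Type*} [LieRing L] [LieAlgebra ℂ L] [FiniteDimensional ℂ L]
  {H : LieSubalgebra ℂ L} [H.IsCartanSubalgebra]

theorem weight_sub_smul (α : Weight ℂ H L) (x y : H) (c : ℂ) : α (x - c • y) = α x - c * α y := by
  rw [← Weight.toLinear_apply, map_sub, map_smul]
  rfl

variable [LieAlgebra.IsSemisimple ℂ L]

theorem lie_rootVector {α : H → ℂ} {x : L} (hx : x ∈ rootSpace H α) (h : H) :
    ⁅(h : L), x⁆ = α h • x := lie_eq_smul_of_mem_rootSpace hx h

/-- Since `ad e` is nilpotent on `h`, the orbit of `h` under its flow is the line `h + ℂ e`. -/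
theorem apply_sub_rootVector {F : PolyFun L} (hF : F ∈ adjointInvariants L)
    {α : Weight ℂ H L} {e : L} (he : e ∈ rootSpace H α) (h : H) :
    (F : L → ℂ) (h - α h • e) = (F : L → ℂ) h := by
  have heh : ⁅e, (h : L)⁆ = -(α h • e) := by rw [← lie_skew, lie_rootVector he]
  have := apply_quadratic_curve (hF (-e)) (u₀ := (h : L)) (u₁ := -(α h • e)) (u₂ := 0)
    (by simp [heh]) (by simp) (by simp)
  simpa [sub_eq_add_neg] using this

theorem apply_sub_smul_coroot (α : Weight ℂ H L) (hα : α.IsNonZero) (h : H) :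
    α (h - α h • coroot α) = -α h := by
  rw [weight_sub_smul, root_apply_coroot hα]
  ring

/-- In an `sl₂`-triple `(k, e, f)` for `α`, the flow of `f` for unit time moves the point
`h - α h • e` of the flow of `e` to the point `s_α h + α h • e`, again on a flow line of `e`. -/
theorem apply_reflection {F : PolyFun L} (hF : F ∈ adjointInvariants L)
    {α : Weight ℂ H L} (hα : α.IsNonZero) (h : H) :
    (F : L → ℂ) (h - α h • coroot α : H) = (F : L → ℂ) h := by
  obtain ⟨k, e, f, ht, he, hf⟩ := exists_isSl2Triple_of_weight_isNonZero hα
  have hk := ht.h_eq_coroot hα he hf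
  have hfh : ⁅f, (h : L)⁆ = α h • f := by
    rw [← lie_skew, lie_rootVector hf]
    simp
  have hfe : ⁅f, e⁆ = -k := by rw [← lie_skew, ht.lie_e_f]
  have hfk : ⁅f, k⁆ = (2 : ℂ) • f := by
    rw [← lie_skew, ht.lie_h_f_nsmul, neg_neg, two_smul, two_smul]
  have flow_f := apply_quadratic_curve (hF f) (u₀ := h - α h • e)
    (u₁ := -(α h • k) - α h • f) (u₂ := α h • f)
    (by
      simp only [LinearMap.neg_apply, ad_apply, lie_sub, lie_smul, hfh, hfe]
      module)
    (by
      simp only [LinearMap.neg_apply, ad_apply, lie_sub, lie_smul, lie_neg, hfk, lie_self]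
      module)
    (by simp)
  have flow_e := apply_sub_rootVector hF (neg_mem he : -e ∈ rootSpace H α) (h - α h • coroot α)
  have hs : ((h - α h • coroot α : H) : L) = h - α h • k := by rw [hk]; rfl
  rw [apply_sub_rootVector hF he h] at flow_f
  rw [← flow_f, ← flow_e, apply_sub_smul_coroot α hα, hs]
  refine congrArg (F : L → ℂ) ?_
  module

theorem mem_weylInvariants_iff {f : PolyFun H} :
    f ∈ weylInvariants H ↔ ∀ α : Weight ℂ H L, α.IsNonZero → ∀ h : H,
      (f : H → ℂ) (h - α h • coroot α) = (f : H → ℂ) h := by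
  refine ⟨fun hf α hα h => ?_, ?_⟩
  · have := hf (RootPairing.weylGroup.ofIdx _ (⟨α, by simpa using hα⟩ : H.root))
    exact congrArg (fun g : PolyFun H => (g : H → ℂ) h) this
  · rintro hf ⟨w, hw⟩
    induction hw using RootPairing.weylGroup.induction with
    | mem α => exact PolyFun.ext fun h => hf α (H.isNonZero_coe_root α) h
    | one => exact congrArg (fun g => g f) (map_one (weylAction H))
    | mul x y hx hy h₁ h₂ =>
      refine (congrArg (fun g => g f) (map_mul (weylAction H) ⟨x, hx⟩ ⟨y, hy⟩)).trans ?_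
      rw [AlgHom.mul_apply, h₂, h₁]

theorem restrict_mem_weylInvariants {F : PolyFun L} (hF : F ∈ adjointInvariants L) :
    restrict H F ∈ weylInvariants H :=
  mem_weylInvariants_iff.2 fun _ hα h => apply_reflection hF hα h

end Restriction

section Injectivity

open LieAlgebra LieAlgebra.IsKilling LieModule

variable {L : Type*} [LieRing L] [LieAlgebra ℂ L]

theorem lie_dirDeriv (x v : L) (F : PolyFun L) :
    ⁅x, dirDeriv L v F⁆ = dirDeriv L v ⁅x, F⁆ + dirDeriv L ⁅x, v⁆ F := by
  have h : ⁅vectorField (-toEnd ℂ L L x), dirDeriv L v⁆ = dirDeriv L ⁅x, v⁆ :=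
    derivation_ext fun l => by
      simp [Derivation.commutator_apply, vectorField_linear, dirDeriv_linearPart]
  rw [← h, Derivation.commutator_apply, ← lie_polyFun, ← lie_polyFun, add_sub_cancel]

/-- The subrepresentation of `ℂ[L]` spanned by the directional derivatives of the elements of a
subrepresentation. -/
def derivSpan (P : LieSubmodule ℂ L (PolyFun L)) : LieSubmodule ℂ L (PolyFun L) where
  __ := Submodule.span ℂ {F | ∃ v, ∃ G ∈ P, dirDeriv L v G = F}
  lie_mem {x F} hF := by
    let Q : Submodule ℂ (PolyFun L) := Submodule.span ℂ {F | ∃ v, ∃ G ∈ P, dirDeriv L v G = F}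
    suffices Q ≤ Q.comap (toEnd ℂ L (PolyFun L) x) from this hF
    refine Submodule.span_le.2 ?_
    rintro _ ⟨v, G, hG, rfl⟩
    change ⁅x, dirDeriv L v G⁆ ∈ Q
    rw [lie_dirDeriv]
    exact add_mem (Submodule.subset_span ⟨v, _, P.lie_mem hG, rfl⟩)
      (Submodule.subset_span ⟨_, G, hG, rfl⟩)

theorem dirDeriv_mem_derivSpan {P : LieSubmodule ℂ L (PolyFun L)} (v : L) {G : PolyFun L}
    (hG : G ∈ P) : dirDeriv L v G ∈ derivSpan P :=
  Submodule.subset_span ⟨v, G, hG, rfl⟩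

theorem eq_top_of_rootSpace_le [FiniteDimensional ℂ L] {H : LieSubalgebra ℂ L}
    [H.IsCartanSubalgebra] {p : Submodule ℂ L} (hH : ∀ h : H, (h : L) ∈ p)
    (hα : ∀ α : Weight ℂ H L, α.IsNonZero → ∀ x ∈ rootSpace H α, x ∈ p) : p = ⊤ := by
  have htop := congrArg LieSubmodule.toSubmodule (iSup_genWeightSpace_eq_top' ℂ H L)
  rw [LieSubmodule.iSup_toSubmodule, LieSubmodule.top_toSubmodule] at htop
  rw [eq_top_iff, ← htop, iSup_le_iff]
  intro α x hx
  by_cases h : α.IsZero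
  · have hx' : x ∈ rootSpace H (0 : H → ℂ) := h ▸ hx
    rw [rootSpace_zero_eq] at hx'
    exact hH ⟨x, hx'⟩
  · exact hα α h x hx

variable [FiniteDimensional ℂ L] [LieAlgebra.IsSemisimple ℂ L] {H : LieSubalgebra ℂ L}
  [H.IsCartanSubalgebra]

/-- The values of `F` on `H` determine `∂_v F` there for `v ∈ H`; for a root vector `v` of weight
`α` one has `α • ∂_v F = v · F` on `H`, which determines `∂_v F` on the dense set `α ≠ 0`. -/
theorem restrict_dirDeriv_eq_zero {G : PolyFun L} (hG : restrict H G = 0)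
    (hLG : ∀ x : L, restrict H ⁅x, G⁆ = 0) (v : L) : restrict H (dirDeriv L v G) = 0 := by
  let φ : L →ₗ[ℂ] PolyFun H :=
    IsLinearMap.mk' (fun v => restrict H (dirDeriv L v G)) ⟨by simp, by simp⟩
  suffices LinearMap.ker φ = ⊤ from
    LinearMap.congr_fun (LinearMap.ker_eq_top.1 this) v
  refine eq_top_of_rootSpace_le (H := H) (fun h => PolyFun.ext fun y => ?_) fun α hα x hxα => ?_
  · have hline (t : ℂ) : (G : L → ℂ) (y + t • h) = 0 :=
      congrArg (fun g : PolyFun H => (g : H → ℂ) (y + t • h)) hG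
    change deriv (fun t : ℂ => (G : L → ℂ) (y + t • h)) 0 = 0
    simp only [hline, deriv_const]
  · have hmul : linearPart H α.toLinear * restrict H (dirDeriv L x G) = 0 := by
      rw [← hLG x]
      ext h
      change α h * (dirDeriv L x G : L → ℂ) h = (dirDeriv L (-⁅x, (h : L)⁆) G : L → ℂ) h
      rw [lie_skew, lie_rootVector hxα, map_smul]
      rfl
    refine (mul_eq_zero.1 hmul).resolve_left fun h0 => hα ?_
    exact funext fun h => congrArg (fun g : PolyFun H => (g : H → ℂ) h) h0

theorem restrict_dirDeriv_iterate_eq_zero (v : L) (k : ℕ) {P : LieSubmodule ℂ L (PolyFun L)}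
    (hP : ∀ G ∈ P, restrict H G = 0) {G : PolyFun L} (hG : G ∈ P) :
    restrict H ((dirDeriv L v)^[k] G) = 0 := by
  induction k generalizing P G with
  | zero => exact hP G hG
  | succ _ ih =>
    have hle : (derivSpan P).toSubmodule ≤ LinearMap.ker (restrict H).toLinearMap := by
      refine Submodule.span_le.2 ?_
      rintro _ ⟨w, F, hF, rfl⟩
      exact restrict_dirDeriv_eq_zero (hP F hF) (fun x => hP _ (P.lie_mem hF)) w
    exact ih (fun F hF => hle hF) (dirDeriv_mem_derivSpan v hG)

theorem eq_bot_of_restrict_eq_zero {P : LieSubmodule ℂ L (PolyFun L)}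
    (hP : ∀ G ∈ P, restrict H G = 0) : P = ⊥ :=
  (LieSubmodule.eq_bot_iff _).2 fun _ hG => eq_zero_of_dirDeriv_iterate_eq_zero fun v k =>
    congrArg (fun g : PolyFun H => (g : H → ℂ) 0) (restrict_dirDeriv_iterate_eq_zero v k hP hG)

theorem eq_zero_of_restrict_eq_zero {F : PolyFun L} (hF : F ∈ adjointInvariants L)
    (h : restrict H F = 0) : F = 0 := by
  let P : LieSubmodule ℂ L (PolyFun L) :=
    { __ := Submodule.span ℂ {F}
      lie_mem := fun {x G} hG => by
        obtain ⟨c, rfl⟩ := Submodule.mem_span_singleton.1 hG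
        have hFx : ⁅x, F⁆ = 0 := hF x
        rw [lie_smul, hFx, smul_zero]
        exact Submodule.zero_mem _ }
  have hP : P = ⊥ := eq_bot_of_restrict_eq_zero (H := H) fun G hG => by
    obtain ⟨c, rfl⟩ := Submodule.mem_span_singleton.1 hG
    rw [map_smul, h, smul_zero]
  exact (LieSubmodule.eq_bot_iff _).1 hP F (Submodule.mem_span_singleton_self F)

end Injectivity

section Trace

open LieModule

variable {L ι : Type*} [LieRing L] [LieAlgebra ℂ L] {V : Type*} [AddCommGroup V] [Module ℂ V]
  [LieRingModule L V] [LieModule ℂ L V] [Fintype ι] [DecidableEq ι]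

variable (L) in
/-- The matrix of the action of the generic element of `L` in a basis of a representation; its
entries are linear functions on `L`. -/
def genericMatrix (b : Basis ι ℂ V) : Matrix ι ι (PolyFun L) :=
  Matrix.of fun i j =>
    linearPart L (b.coord i ∘ₗ (toEnd ℂ L V : L →ₗ[ℂ] End ℂ V).flip (b j))

theorem genericMatrix_map_evalAt (b : Basis ι ℂ V) (y : L) :
    (genericMatrix L b).map (evalAt y) = LinearMap.toMatrix b b (toEnd ℂ L V y) := by
  ext i j
  rw [LinearMap.toMatrix_apply]
  rfl

theorem map_adjointAction_genericMatrix (b : Basis ι ℂ V) (x : L) :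
    let Z := (LinearMap.toMatrix b b (toEnd ℂ L V x)).map (algebraMap ℂ (PolyFun L))
    (genericMatrix L b).map (adjointAction L x) =
      genericMatrix L b * Z - Z * genericMatrix L b := by
  intro Z
  have hZ (y : L) : Z.map (evalAt y) = LinearMap.toMatrix b b (toEnd ℂ L V x) := rfl
  have hD (y : L) : ((genericMatrix L b).map (adjointAction L x)).map (evalAt y) =
      (genericMatrix L b).map (evalAt (-⁅x, y⁆)) := by
    ext i j
    exact lineDeriv_linear _ y _
  have hlie (y : L) : toEnd ℂ L V (-⁅x, y⁆) =
      toEnd ℂ L V y * toEnd ℂ L V x - toEnd ℂ L V x * toEnd ℂ L V y := by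
    ext
    simp
  ext i j y
  change ((genericMatrix L b).map (adjointAction L x)).map (evalAt y) i j =
    (genericMatrix L b * Z - Z * genericMatrix L b).map (evalAt y) i j
  rw [hD, Matrix.map_sub _ (map_sub _), Matrix.map_mul, Matrix.map_mul, hZ,
    genericMatrix_map_evalAt, genericMatrix_map_evalAt, hlie, map_sub, LinearMap.toMatrix_mul,
    LinearMap.toMatrix_mul]

theorem exists_mem_adjointInvariants_trace_pow [FiniteDimensional ℂ V] (n : ℕ) :
    ∃ F ∈ adjointInvariants L, ∀ y,
      (F : L → ℂ) y = LinearMap.trace ℂ V (toEnd ℂ L V y ^ n) := by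
  let b := finBasis ℂ V
  refine ⟨Matrix.trace (genericMatrix L b ^ n), fun x => derivation_trace_pow_eq_zero _
    (map_adjointAction_genericMatrix b x) n, fun y => ?_⟩
  have hpow := map_pow (evalAt y).mapMatrix (genericMatrix L b) n
  simp only [AlgHom.mapMatrix_apply] at hpow
  rw [← evalAt_apply, AddMonoidHom.map_trace (evalAt y), hpow, genericMatrix_map_evalAt,
    LinearMap.trace_eq_matrix_trace ℂ b, LinearMap.toMatrix_pow]

end Trace

section PowerSums

open LieAlgebra LieAlgebra.IsKilling LieModule

variable {L : Type*} [LieRing L] [LieAlgebra ℂ L] [FiniteDimensional ℂ L]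
  [LieAlgebra.IsSemisimple ℂ L] {H : LieSubalgebra ℂ L} [H.IsCartanSubalgebra]

theorem ad_pow_rootVector (h : H) (n : ℕ) (χ : Weight ℂ H L) {x : L} (hx : x ∈ rootSpace H χ) :
    (ad ℂ L h ^ n) x = χ h ^ n • x := by
  induction n with
  | zero => simp
  | succ n ih =>
    rw [pow_succ', End.mul_apply, ih, map_smul, ad_apply, lie_rootVector hx, smul_smul, pow_succ]

theorem trace_ad_pow_eq_sum_weight (h : H) (n : ℕ) : LinearMap.trace ℂ L (ad ℂ L h ^ n) =
    ∑ χ : Weight ℂ H L, χ h ^ n * finrank ℂ (rootSpace H χ) := by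
  classical
  have hinternal := DirectSum.isInternal_submodule_of_iSupIndep_of_iSup_eq_top
    (LieSubmodule.iSupIndep_toSubmodule.mpr <| iSupIndep_genWeightSpace' ℂ H L)
    (LieSubmodule.iSup_toSubmodule_eq_top.mpr <| iSup_genWeightSpace_eq_top' ℂ H L)
  have hmaps (χ : Weight ℂ H L) :
      Set.MapsTo (ad ℂ L h ^ n) (rootSpace H χ).toSubmodule (rootSpace H χ).toSubmodule :=
    fun x hx => by
      rw [ad_pow_rootVector h n χ hx]
      exact Submodule.smul_mem _ _ hx
  rw [LinearMap.trace_eq_sum_trace_restrict hinternal hmaps]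
  refine Finset.sum_congr rfl fun χ _ => ?_
  have hscalar : (ad ℂ L h ^ n).restrict (hmaps χ) = χ h ^ n • LinearMap.id :=
    LinearMap.ext fun x => Subtype.ext (ad_pow_rootVector h n χ x.2)
  rw [hscalar, map_smul, LinearMap.trace_id, smul_eq_mul]
  rfl

theorem trace_ad_pow (h : H) {n : ℕ} (hn : n ≠ 0) :
    LinearMap.trace ℂ L (ad ℂ L h ^ n) = ∑ α : H.root, (α : Weight ℂ H L) h ^ n := by
  rw [trace_ad_pow_eq_sum_weight, ← Finset.sum_subset (Finset.subset_univ H.root),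
    ← Finset.sum_coe_sort]
  · refine Finset.sum_congr rfl fun α _ => ?_
    rw [finrank_rootSpace_eq_one _ (H.isNonZero_coe_root α), Nat.cast_one, mul_one]
  · intro χ _ hχ
    have hχ0 : χ.IsZero := by simpa using hχ
    rw [congrFun hχ0 h, Pi.zero_apply, zero_pow hn, zero_mul]

theorem sum_root_pow_mem_map_restrict {n : ℕ} (hn : n ≠ 0) :
    ∑ α : H.root, linearPart H (α : Weight ℂ H L).toLinear ^ n ∈
      (adjointInvariants L).map (restrict H) := by
  obtain ⟨F, hF, hFy⟩ := exists_mem_adjointInvariants_trace_pow (L := L) (V := L) n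
  refine ⟨F, hF, PolyFun.ext fun h => ?_⟩
  rw [PolyFun.sum_apply]
  exact (hFy h).trans (trace_ad_pow h hn)

end PowerSums

section HighestWeight

open LieModule

variable {L V : Type*} [LieRing L] [AddCommGroup V] [Module ℂ V] [LieRingModule L V]

/-- The smallest subspace containing `v` and stable under `N`: for a highest weight vector `v` and
the negative root vectors `N`, the subrepresentation generated by `v`. -/
def lowerSpan (N : Set L) (v : V) : Submodule ℂ V :=
  sInf {p | v ∈ p ∧ ∀ x ∈ N, ∀ w ∈ p, ⁅x, w⁆ ∈ p}

variable {N P : Set L} {v : V}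

theorem mem_lowerSpan_self : v ∈ lowerSpan N v :=
  Submodule.mem_sInf.2 fun _ hp => hp.1

theorem lie_mem_lowerSpan_of_mem {x : L} (hx : x ∈ N) {w : V} (hw : w ∈ lowerSpan N v) :
    ⁅x, w⁆ ∈ lowerSpan N v :=
  Submodule.mem_sInf.2 fun p hp => hp.2 x hx w (Submodule.mem_sInf.1 hw p hp)

theorem lowerSpan_le {p : Submodule ℂ V} (hv : v ∈ p) (hp : ∀ x ∈ N, ∀ w ∈ p, ⁅x, w⁆ ∈ p) :
    lowerSpan N v ≤ p :=
  sInf_le ⟨hv, hp⟩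

variable [LieAlgebra ℂ L] [LieModule ℂ L V]

theorem lie_mem_lowerSpan (hNP : Submodule.span ℂ (N ∪ P) = ⊤)
    (hP : ∀ x ∈ P, ∃ c : ℂ, ⁅x, v⁆ = c • v) (x : L) {w : V} (hw : w ∈ lowerSpan N v) :
    ⁅x, w⁆ ∈ lowerSpan N v := by
  set S := lowerSpan N v
  have hv (x : L) : ⁅x, v⁆ ∈ S := by
    suffices (⊤ : Submodule ℂ L) ≤ S.comap ((toEnd ℂ L V : L →ₗ[ℂ] End ℂ V).flip v) from
      this (Submodule.mem_top (x := x))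
    rw [← hNP, Submodule.span_le]
    rintro x (hx | hx)
    · exact lie_mem_lowerSpan_of_mem hx mem_lowerSpan_self
    · obtain ⟨c, hc⟩ := hP x hx
      change ⁅x, v⁆ ∈ S
      exact hc ▸ S.smul_mem c mem_lowerSpan_self
  have hS : S ≤ S ⊓ ⨅ x, S.comap (toEnd ℂ L V x) := by
    refine lowerSpan_le ⟨mem_lowerSpan_self, (Submodule.mem_iInf _).2 hv⟩ fun y hy w hw =>
      ⟨lie_mem_lowerSpan_of_mem hy hw.1, (Submodule.mem_iInf _).2 fun x => ?_⟩
    have hxw (x : L) : ⁅x, w⁆ ∈ S := (Submodule.mem_iInf _).1 hw.2 x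
    change ⁅x, ⁅y, w⁆⁆ ∈ S
    rw [leibniz_lie]
    exact add_mem (hxw _) (lie_mem_lowerSpan_of_mem hy (hxw x))
  exact (Submodule.mem_iInf _).1 (hS hw).2 x

theorem lowerSpan_le_iSup_eigenspace {k : L} {a : ℂ}
    (hk : ∀ x ∈ N, ∃ m : ℕ, ⁅k, x⁆ = -(m : ℂ) • x) (hv : ⁅k, v⁆ = a • v) :
    lowerSpan N v ≤ ⨆ m : ℕ, (toEnd ℂ L V k).eigenspace (a - m) := by
  set E := ⨆ m : ℕ, (toEnd ℂ L V k).eigenspace (a - m)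
  refine lowerSpan_le (Submodule.mem_iSup_of_mem 0 ?_) fun x hx => ?_
  · simpa [End.mem_eigenspace_iff] using hv
  · suffices E ≤ E.comap (toEnd ℂ L V x) from this
    refine iSup_le fun m y hy => ?_
    obtain ⟨n, hn⟩ := hk x hx
    refine Submodule.mem_iSup_of_mem (m + n) ?_
    rw [End.mem_eigenspace_iff, toEnd_apply_apply] at hy ⊢
    rw [toEnd_apply_apply, leibniz_lie, hn, hy, smul_lie, lie_smul, ← add_smul]
    push_cast
    ring_nf

theorem exists_eq_sub_natCast_of_mem_lowerSpan {k : L} {a : ℂ}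
    (hk : ∀ x ∈ N, ∃ m : ℕ, ⁅k, x⁆ = -(m : ℂ) • x) (hv : ⁅k, v⁆ = a • v) {w : V}
    (hw : w ∈ lowerSpan N v) (hw0 : w ≠ 0) {c : ℂ} (hc : ⁅k, w⁆ = c • w) :
    ∃ m : ℕ, c = a - m := by
  by_contra! hne
  have hdisj := (toEnd ℂ L V k).eigenspaces_iSupIndep c
  refine hw0 (Submodule.disjoint_def.1 hdisj w (End.mem_eigenspace_iff.2 hc) ?_)
  have hle : (⨆ m : ℕ, (toEnd ℂ L V k).eigenspace (a - m)) ≤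
      ⨆ b, ⨆ (_ : b ≠ c), (toEnd ℂ L V k).eigenspace b :=
    iSup_le fun m => le_iSup₂_of_le (a - m) (hne m).symm le_rfl
  exact hle (lowerSpan_le_iSup_eigenspace hk hv hw)

/-- If the invariants do not separate `k` from `k'`, then `k` and `k'` have the same eigenvalues on
the subrepresentation generated by `v`; by dominance the highest one is `a`, respectively `a'`. -/
theorem weight_eq_of_invariants_eq [FiniteDimensional ℂ (lowerSpan N v)]
    (hNP : Submodule.span ℂ (N ∪ P) = ⊤)
    (hP : ∀ x ∈ P, ∃ c : ℂ, ⁅x, v⁆ = c • v) (hv0 : v ≠ 0) {k k' : L} {a a' : ℂ}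
    (hk : ∀ x ∈ N, ∃ m : ℕ, ⁅k, x⁆ = -(m : ℂ) • x) (hv : ⁅k, v⁆ = a • v)
    (hk' : ∀ x ∈ N, ∃ m : ℕ, ⁅k', x⁆ = -(m : ℂ) • x) (hv' : ⁅k', v⁆ = a' • v)
    (hF : ∀ F ∈ adjointInvariants L, (F : L → ℂ) k = (F : L → ℂ) k') : a = a' := by
  let S : LieSubmodule ℂ L V :=
    { __ := lowerSpan N v, lie_mem := fun hw => lie_mem_lowerSpan hNP hP _ hw }
  have : FiniteDimensional ℂ S := ‹FiniteDimensional ℂ (lowerSpan N v)›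
  have htrace (n : ℕ) : LinearMap.trace ℂ S (toEnd ℂ L S k ^ n) =
      LinearMap.trace ℂ S (toEnd ℂ L S k' ^ n) := by
    obtain ⟨F, hFi, hFy⟩ := exists_mem_adjointInvariants_trace_pow (L := L) (V := S) n
    rw [← hFy, ← hFy, hF F hFi]
  have heigen {x : L} {c : ℂ} (hx : ⁅x, v⁆ = c • v) : (toEnd ℂ L S x).HasEigenvalue c :=
    End.hasEigenvalue_of_hasEigenvector (x := (⟨v, mem_lowerSpan_self⟩ : S))
      (End.hasEigenvector_iff.2 ⟨End.mem_eigenspace_iff.2 (Subtype.ext hx),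
        fun h => hv0 (congrArg Subtype.val h)⟩)
  have hbound {x : L} {b c : ℂ} (hx : ∀ y ∈ N, ∃ m : ℕ, ⁅x, y⁆ = -(m : ℂ) • y)
      (hxv : ⁅x, v⁆ = b • v) (hc : (toEnd ℂ L S x).HasEigenvalue c) : ∃ m : ℕ, c = b - m := by
    obtain ⟨w, hw⟩ := hc.exists_hasEigenvector
    exact exists_eq_sub_natCast_of_mem_lowerSpan hx hxv w.2 (fun h => hw.2 (Subtype.ext h))
      (congrArg Subtype.val hw.apply_eq_smul)
  obtain ⟨m, hm⟩ := hbound hk' hv' (hasEigenvalue_of_trace_pow_eq htrace (heigen hv))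
  obtain ⟨n, hn⟩ := hbound hk hv
    (hasEigenvalue_of_trace_pow_eq (fun n => (htrace n).symm) (heigen hv'))
  have hmn : ((m + n : ℕ) : ℂ) = 0 := by
    push_cast
    linear_combination hm + hn
  have hm0 : m = 0 := (Nat.add_eq_zero_iff.1 (Nat.cast_eq_zero.1 hmn)).1
  rw [hm, hm0, Nat.cast_zero, sub_zero]

end HighestWeight

section Determinant

variable {L ι : Type*} [LieRing L] [LieAlgebra ℂ L]

/-- The linear function `y ↦ κ(z, yⱼ)` on `L ^ ι`, where `κ` is the Killing form. -/
def killingCoord (z : L) (j : ι) : PolyFun (ι → L) :=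
  linearPart (ι → L) (killingForm ℂ L z ∘ₗ LinearMap.proj j)

theorem lie_killingCoord (x z : L) (j : ι) : ⁅x, killingCoord z j⁆ = killingCoord ⁅x, z⁆ j := by
  rw [killingCoord, lie_polyFun, vectorField_linear, killingCoord]
  refine congrArg (linearPart (ι → L)) (LinearMap.ext fun y => ?_)
  have : LieModule.toEnd ℂ L (ι → L) x y j = ⁅x, y j⁆ := rfl
  simp only [LinearMap.comp_apply, LinearMap.neg_apply, LinearMap.proj_apply, map_neg, this]
  rw [LieModule.traceForm_apply_lie_apply']

theorem killingCoord_smul (c : ℂ) (z : L) :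
    (killingCoord (c • z) : ι → PolyFun (ι → L)) = c • killingCoord z := by
  funext j
  simp only [killingCoord, map_smul, LinearMap.smul_comp, Pi.smul_apply]

variable [Fintype ι] [DecidableEq ι]

/-- The function `y ↦ det (κ(eᵢ, yⱼ))` on `L ^ ι`. The functions `killingDet e` span a copy of the
exterior power of `L` in `ℂ[L ^ ι]`; those on root vectors serve as highest weight vectors. -/
def killingDet (e : ι → L) : PolyFun (ι → L) :=
  (Matrix.of fun i => killingCoord (e i)).det

theorem killingDet_update (e : ι → L) (i : ι) (z : L) : killingDet (Function.update e i z) =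
    ((Matrix.of fun i => killingCoord (e i)).updateRow i (killingCoord z)).det := by
  refine congrArg Matrix.det (Matrix.ext fun k j => ?_)
  rw [Matrix.of_apply]
  rcases eq_or_ne k i with rfl | hk
  · rw [Function.update_self, Matrix.updateRow_self]
  · rw [Function.update_of_ne hk, Matrix.updateRow_ne hk, Matrix.of_apply]

theorem killingDet_update_smul (e : ι → L) (i : ι) (c : ℂ) (z : L) :
    killingDet (Function.update e i (c • z)) = c • killingDet (Function.update e i z) := by
  have hsmul (f : ι → PolyFun (ι → L)) : c • f = algebraMap ℂ (PolyFun (ι → L)) c • f :=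
    (algebraMap_smul _ c f).symm
  rw [killingDet_update, killingDet_update, killingCoord_smul, hsmul, Matrix.det_updateRow_smul,
    Algebra.smul_def]

theorem killingDet_eq_zero {e : ι → L} {i j : ι} (hij : i ≠ j) (h : e i = e j) :
    killingDet e = 0 :=
  Matrix.det_zero_of_row_eq hij (congrArg killingCoord h)

theorem lie_killingDet (x : L) (e : ι → L) :
    ⁅x, killingDet e⁆ = ∑ i, killingDet (Function.update e i ⁅x, e i⁆) := by
  rw [lie_polyFun, killingDet, derivation_det]
  refine Finset.sum_congr rfl fun i _ => ?_
  rw [killingDet_update, ← funext (lie_killingCoord x (e i))]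
  rfl

theorem killingDet_mem_homogeneous (e : ι → L) :
    killingDet e ∈ homogeneous (ι → L) (Fintype.card ι) := by
  rw [killingDet, Matrix.det_apply]
  refine sum_mem fun σ _ => ?_
  rw [Units.smul_def]
  refine zsmul_mem ?_ _
  have := SetLike.prod_mem_graded (homogeneous (ι → L)) (F := Finset.univ) (fun _ => 1)
    (fun i => killingCoord (e (σ i)) i) fun i _ => linearPart_mem_homogeneous _
  simpa using this

theorem killingDet_apply (e y : ι → L) :
    (killingDet e : (ι → L) → ℂ) y = (Matrix.of fun i j => killingForm ℂ L (e i) (y j)).det := by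
  rw [← evalAt_apply, killingDet, AlgHom.map_det]
  rfl

end Determinant

section Dominance

open LieAlgebra LieAlgebra.IsKilling LieModule

variable {L : Type*} [LieRing L] [LieAlgebra ℂ L] {H : LieSubalgebra ℂ L} [H.IsCartanSubalgebra]

theorem intCast_weight_add {h : H} {z : Weight ℂ H L → ℤ}
    (hz : ∀ α : Weight ℂ H L, α h = z α) {α β γ : Weight ℂ H L} (hγ : (γ : H → ℂ) = α + β) :
    z γ = z α + z β := by
  have : ((z γ : ℤ) : ℂ) = z α + z β := by rw [← hz, ← hz, ← hz, hγ]; rfl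
  exact_mod_cast this

theorem isNonZero_of_intCast_weight_ne_zero {h : H} {z : Weight ℂ H L → ℤ}
    (hz : ∀ α : Weight ℂ H L, α h = z α) {α : Weight ℂ H L} (hα : z α ≠ 0) : α.IsNonZero :=
  fun h0 => hα (Int.cast_injective ((hz α).symm.trans ((congrFun h0 h).trans Int.cast_zero.symm)))

variable [FiniteDimensional ℂ L]

theorem span_rootVectors_union (p : Weight ℂ H L → Prop) :
    Submodule.span ℂ ({x | ∃ α, p α ∧ x ∈ rootSpace H (α : Weight ℂ H L)} ∪
      {x | ∃ α, ¬p α ∧ x ∈ rootSpace H (α : Weight ℂ H L)}) = (⊤ : Submodule ℂ L) := by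
  rw [eq_top_iff, ← LieSubmodule.iSup_toSubmodule_eq_top.2 (iSup_genWeightSpace_eq_top' ℂ H L)]
  refine iSup_le fun α x hx => Submodule.subset_span ?_
  exact (em (p α)).imp (fun h => ⟨α, h, hx⟩) fun h => ⟨α, h, hx⟩

variable [LieAlgebra.IsSemisimple ℂ L]

theorem eq_smul_of_mem_rootSpace {α : Weight ℂ H L} (hα : α.IsNonZero) {x e : L}
    (hx : x ∈ rootSpace H α) (he : e ∈ rootSpace H α) (he0 : e ≠ 0) : ∃ c : ℂ, x = c • e := by
  obtain ⟨c, hc⟩ := (finrank_eq_one_iff_of_nonzero' (⟨e, he⟩ : rootSpace H α)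
    (fun h => he0 (congrArg Subtype.val h))).1 (finrank_rootSpace_eq_one α hα) ⟨x, hx⟩
  exact ⟨c, (congrArg Subtype.val hc).symm⟩

section

variable {ι : Type*} [Fintype ι] [DecidableEq ι] {a : ι → Weight ℂ H L} {e : ι → L}

theorem lie_cartan_killingDet (he : ∀ i, e i ∈ rootSpace H (a i)) (k : H) :
    ⁅(k : L), killingDet e⁆ = (∑ i, a i k) • killingDet e := by
  rw [lie_killingDet, Finset.sum_smul]
  refine Finset.sum_congr rfl fun i _ => ?_
  rw [lie_rootVector (he i), killingDet_update_smul, Function.update_eq_self]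

theorem lie_rootVector_killingDet_eq_zero (he : ∀ i, e i ∈ rootSpace H (a i))
    (he0 : ∀ i, e i ≠ 0) {α : Weight ℂ H L} (hα : α.IsNonZero)
    (hadd : ∀ (i : ι) (γ : Weight ℂ H L), (γ : H → ℂ) = α + a i → γ.IsNonZero ∧ ∃ j, a j = γ)
    {x : L} (hx : x ∈ rootSpace H α) : ⁅x, killingDet e⁆ = 0 := by
  rw [lie_killingDet]
  refine Finset.sum_eq_zero fun i _ => ?_
  have hmem : ⁅x, e i⁆ ∈ rootSpace H (α + a i : H → ℂ) :=
    lie_mem_genWeightSpace_of_mem_genWeightSpace hx (he i)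
  by_cases h0 : ⁅x, e i⁆ = 0
  · rw [h0, ← zero_smul ℂ (0 : L), killingDet_update_smul, zero_smul]
  · let γ : Weight ℂ H L := ⟨α + a i, fun hbot => h0 (by simpa [hbot] using hmem)⟩
    obtain ⟨hγ, j, hj⟩ := hadd i γ rfl
    have hji : j ≠ i := by
      rintro rfl
      have : (a j : H → ℂ) = α + a j := congrArg DFunLike.coe hj
      exact hα (by simpa using this)
    obtain ⟨c, hc⟩ := eq_smul_of_mem_rootSpace hγ hmem (hj ▸ he j) (he0 j)
    rw [hc, killingDet_update_smul, killingDet_eq_zero hji, smul_zero]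
    rw [Function.update_of_ne hji, Function.update_self]

theorem killingDet_ne_zero (ha : Function.Injective a)
    (he : ∀ i, e i ∈ rootSpace H (a i)) (he0 : ∀ i, e i ≠ 0) : killingDet e ≠ 0 := by
  have hdual (i : ι) : ∃ f ∈ rootSpace H (-a i : H → ℂ), killingForm ℂ L (e i) f ≠ 0 := by
    by_contra! h
    have hker := mem_ker_killingForm_of_mem_rootSpace_of_forall_rootSpace_neg ℂ L H (he i) h
    exact he0 i (by simpa using hker)
  choose f hf hef using hdual
  have hdiag : (Matrix.of fun i j => killingForm ℂ L (e i) (f j)) =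
      Matrix.diagonal fun i => killingForm ℂ L (e i) (f i) := by
    ext i j
    rcases eq_or_ne i j with rfl | hij
    · simp
    · rw [Matrix.diagonal_apply_ne _ hij, Matrix.of_apply]
      refine killingForm_apply_eq_zero_of_mem_rootSpace_of_add_ne_zero ℂ L H (he i) (hf j) ?_
      intro h
      exact hij (ha (DFunLike.coe_injective (by simpa [← sub_eq_add_neg, sub_eq_zero] using h)))
  intro h0
  have hdet := killingDet_apply e f
  rw [h0, hdiag, Matrix.det_diagonal] at hdet
  exact Finset.prod_ne_zero_iff.2 (fun i _ => hef i) hdet.symm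

end

section IntegralPoint

variable {h : H} {z : Weight ℂ H L → ℤ} (hz : ∀ α : Weight ℂ H L, α h = z α)

include hz

theorem intCast_weight_neg (α : Weight ℂ H L) : z (-α) = -z α := by
  have : ((z (-α) : ℤ) : ℂ) = -(z α : ℤ) := by rw [← hz, ← hz]; rfl
  exact_mod_cast this

theorem exists_lie_eq_neg_natCast_smul {α : Weight ℂ H L} (hα : z α ≤ 0) {x : L}
    (hx : x ∈ rootSpace H α) : ∃ m : ℕ, ⁅(h : L), x⁆ = -(m : ℂ) • x := by
  obtain ⟨m, hm⟩ := Int.exists_eq_neg_ofNat hα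
  refine ⟨m, ?_⟩
  rw [lie_rootVector hx, hz, hm]
  push_cast
  rfl

theorem exists_lie_killingDet_eq_smul {t : ℕ} {e : {α : Weight ℂ H L // t < z α} → L}
    [DecidableEq {α : Weight ℂ H L // t < z α}]
    (he : ∀ i, e i ∈ rootSpace H i.1) (he0 : ∀ i, e i ≠ 0) {α : Weight ℂ H L} (hα : 0 ≤ z α)
    {x : L} (hx : x ∈ rootSpace H α) : ∃ c : ℂ, ⁅x, killingDet e⁆ = c • killingDet e := by
  by_cases hα0 : α.IsZero
  · have hxH : x ∈ H := by
      rwa [hα0.eq, rootSpace_zero_eq] at hx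
    exact ⟨_, lie_cartan_killingDet (a := Subtype.val) he ⟨x, hxH⟩⟩
  · refine ⟨0, ?_⟩
    rw [zero_smul]
    refine lie_rootVector_killingDet_eq_zero (a := Subtype.val) he he0 hα0 (fun i γ hγ => ?_) hx
    have hzγ := intCast_weight_add hz hγ
    have hγt : (t : ℤ) < z γ := by have := i.2; omega
    exact ⟨isNonZero_of_intCast_weight_ne_zero hz (by omega), ⟨γ, hγt⟩, rfl⟩

variable {h' : H} {z' : Weight ℂ H L → ℤ} (hz' : ∀ α : Weight ℂ H L, α h' = z' α)
  (hdom : ∀ α, 0 < z α → 0 ≤ z' α)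
  (hF : ∀ F ∈ adjointInvariants L, (F : L → ℂ) h = (F : L → ℂ) h')

include hz' hdom hF

/-- The `killingDet` of the root vectors for the roots exceeding `t` at `h` is a highest weight
vector for the Weyl chamber of `h` and `h'`. -/
theorem sum_weight_gt_eq (t : ℕ) : ∑ α with t < z α, z α = ∑ α with t < z α, z' α := by
  classical
  let ι := {α : Weight ℂ H L // t < z α}
  choose e he he0 using fun α : ι => (α : Weight ℂ H L).exists_ne_zero
  let N : Set L := {x | ∃ α, z α < 0 ∧ x ∈ rootSpace H (α : Weight ℂ H L)}
  have : FiniteDimensional ℂ (homogeneous (ι → L) (Fintype.card ι)) :=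
    finiteDimensional_homogeneous _
  have : FiniteDimensional ℂ (lowerSpan N (killingDet e)) :=
    Submodule.finiteDimensional_of_le <| lowerSpan_le (killingDet_mem_homogeneous e)
      fun _ _ _ hw => vectorField_mem_homogeneous _ hw
  have hcartan := lie_cartan_killingDet (a := Subtype.val) he
  have hneg (α : Weight ℂ H L) (hα : z α < 0) : z' α ≤ 0 := by
    have := hdom (-α)
    rw [intCast_weight_neg hz, intCast_weight_neg hz'] at this
    omega
  have key := weight_eq_of_invariants_eq (span_rootVectors_union (z · < 0))
    (fun x ⟨α, hα, hx⟩ => exists_lie_killingDet_eq_smul hz he he0 (not_lt.1 hα) hx)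
    (killingDet_ne_zero Subtype.val_injective he he0)
    (fun x ⟨α, hα, hx⟩ => exists_lie_eq_neg_natCast_smul hz hα.le hx) (hcartan h)
    (fun x ⟨α, hα, hx⟩ => exists_lie_eq_neg_natCast_smul hz' (hneg α hα) hx) (hcartan h') hF
  simp only [hz, hz'] at key
  rw [Finset.sum_subtype (p := fun α => t < z α) _ (by simp),
    Finset.sum_subtype (p := fun α => t < z α) _ (by simp)]
  exact_mod_cast key

theorem sum_weight_mul_eq : ∑ α, z α * z' α = ∑ α, z α * z α := by
  have hpos : ∑ α, ((z α).toNat : ℤ) * (z α - z' α) = 0 :=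
    sum_toNat_mul_eq_zero fun t => by
      rw [Finset.sum_sub_distrib, sum_weight_gt_eq hz hz' hdom hF, sub_self]
  have hneg : ∑ α, ((-z α).toNat : ℤ) * (z' α - z α) = 0 := by
    rw [← hpos]
    refine Fintype.sum_equiv (Equiv.neg (Weight ℂ H L)) _ _ fun α => ?_
    rw [Equiv.neg_apply, intCast_weight_neg hz, intCast_weight_neg hz']
    ring
  rw [← sub_eq_zero, ← neg_eq_zero, ← add_zero 0, ← Finset.sum_sub_distrib]
  nth_rw 1 [← hpos]
  rw [← hneg, ← Finset.sum_neg_distrib, ← Finset.sum_add_distrib]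
  refine Finset.sum_congr rfl fun α _ => ?_
  linear_combination (z α - z' α) * (z α).toNat_sub_toNat_neg.symm

end IntegralPoint

end Dominance

section TraceForm

open LieAlgebra LieAlgebra.IsKilling LieModule

variable {L : Type*} [LieRing L] [LieAlgebra ℂ L] [FiniteDimensional ℂ L]
  {H : LieSubalgebra ℂ L}

theorem traceForm_self_eq_of_invariants_eq {h h' : H}
    (hF : ∀ F ∈ adjointInvariants L, (F : L → ℂ) h = (F : L → ℂ) h') :
    traceForm ℂ H L h h = traceForm ℂ H L h' h' := by
  obtain ⟨F, hFi, hFy⟩ := exists_mem_adjointInvariants_trace_pow (L := L) (V := L) 2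
  have hform (x : H) : traceForm ℂ H L x x = (F : L → ℂ) x := by
    rw [hFy, sq]
    rfl
  rw [hform, hform, hF F hFi]

variable [LieAlgebra.IsSemisimple ℂ L] [H.IsCartanSubalgebra]

theorem eq_zero_of_forall_weight_eq_zero {x : H} (h : ∀ α : Weight ℂ H L, α x = 0) : x = 0 := by
  have hx : x ∈ ⨅ α : Weight ℂ H L, α.ker := (Submodule.mem_iInf _).2 h
  rwa [iInf_ker_weight_eq_bot, Submodule.mem_bot] at hx

theorem finite_setOf_forall_weight_mem {S : Set ℂ} (hS : S.Finite) :
    {x : H | ∀ α : Weight ℂ H L, α x ∈ S}.Finite := by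
  have hinj : Function.Injective fun (x : H) (α : Weight ℂ H L) => α x := fun x y hxy => by
    refine sub_eq_zero.1 (eq_zero_of_forall_weight_eq_zero (L := L) fun α => ?_)
    rw [← one_smul ℂ y, weight_sub_smul, one_mul]
    exact sub_eq_zero.2 (congrFun hxy α)
  exact ((Set.Finite.pi fun _ : Weight ℂ H L => hS).preimage hinj.injOn).subset
    fun x hx α _ => hx α

theorem traceForm_eq_sum_weight (x y : H) :
    traceForm ℂ H L x y = ∑ α : Weight ℂ H L, α x * α y := by
  rw [← restrict_killingForm, restrict_killingForm_eq_sum,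
    ← Finset.sum_subset (Finset.subset_univ H.root)]
  · simp [LinearMap.sum_apply]
  · intro α _ hα
    have hα0 : α.IsZero := by simpa using hα
    rw [congrFun hα0 x, Pi.zero_apply, zero_mul]

theorem traceForm_self_eq_sum_sq {x : H} {z : Weight ℂ H L → ℤ}
    (hz : ∀ α : Weight ℂ H L, α x = z α) : traceForm ℂ H L x x = (∑ α, z α ^ 2 : ℤ) := by
  simp only [traceForm_eq_sum_weight, hz, sq, Int.cast_sum, Int.cast_mul]

theorem eq_zero_of_traceForm_self_eq_zero {x : H} {z : Weight ℂ H L → ℤ}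
    (hz : ∀ α : Weight ℂ H L, α x = z α) (hx : traceForm ℂ H L x x = 0) : x = 0 := by
  rw [traceForm_self_eq_sum_sq hz, Int.cast_eq_zero] at hx
  refine eq_zero_of_forall_weight_eq_zero (L := L) fun α => ?_
  have := (Finset.sum_eq_zero_iff_of_nonneg fun α _ => sq_nonneg (z α)).1 hx α (Finset.mem_univ α)
  rw [hz, pow_eq_zero_iff two_ne_zero |>.1 this, Int.cast_zero]

theorem exists_pos_traceForm_coroot {γ : Weight ℂ H L} (hγ : γ.IsNonZero) :
    ∃ c : ℝ, 0 < c ∧ ∀ x : H, traceForm ℂ H L x (coroot γ) = c * γ x := by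
  set c : ℂ := 2 * (γ ((cartanEquivDual H).symm γ))⁻¹ with hc
  have hform (x : H) : traceForm ℂ H L x (coroot γ) = c * γ x := by
    rw [traceForm_comm, traceForm_coroot, hc, nsmul_eq_mul, smul_eq_mul, mul_assoc]
    rfl
  have hnorm := hform (coroot γ)
  choose n hn using fun α : Weight ℂ H L =>
    (⟨_, apply_coroot_eq_cast γ α⟩ : ∃ n : ℤ, α (coroot γ) = n)
  rw [root_apply_coroot hγ, traceForm_self_eq_sum_sq hn] at hnorm
  have hnγ : n γ ≠ 0 := by
    have : ((n γ : ℤ) : ℂ) = 2 := by rw [← hn, root_apply_coroot hγ]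
    intro h0
    simp [h0] at this
  have hpos : 0 < ∑ α, n α ^ 2 :=
    Finset.sum_pos' (fun α _ => sq_nonneg _) ⟨γ, Finset.mem_univ _, by positivity⟩
  have hcr : c = ((∑ α, n α ^ 2 : ℤ) / 2 : ℝ) := by
    push_cast at hnorm ⊢
    linear_combination -hnorm / 2
  exact ⟨_, by positivity, fun x => hcr ▸ hform x⟩

end TraceForm

section Conjugacy

open LieAlgebra LieAlgebra.IsKilling LieModule

variable {L : Type*} [LieRing L] [LieAlgebra ℂ L] [FiniteDimensional ℂ L]
  [LieAlgebra.IsSemisimple ℂ L] {H : LieSubalgebra ℂ L} [H.IsCartanSubalgebra]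

/-- Among the finitely many points whose weights occur at `h'` and which the `W`-invariants do not
separate from `h'`, one with the largest Killing product with `h` lies in the chamber of `h`. -/
theorem exists_dominant (h h' : H) : ∃ x : H,
    (∀ α : Weight ℂ H L, ∃ β : Weight ℂ H L, α x = β h') ∧
    (∀ g ∈ weylInvariants H, (g : H → ℂ) x = (g : H → ℂ) h') ∧
    ∀ γ : Weight ℂ H L, γ.IsNonZero → 0 ≤ (γ h * γ x).re := by
  let O : Set H := {x | (∀ α : Weight ℂ H L, α x ∈ Set.range fun β : Weight ℂ H L => β h') ∧
    ∀ g ∈ weylInvariants H, (g : H → ℂ) x = (g : H → ℂ) h'}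
  have hfin : O.Finite :=
    (finite_setOf_forall_weight_mem (Set.finite_range _)).subset fun x hx => hx.1
  obtain ⟨x, hx, hmax⟩ := Set.exists_max_image O (fun y => (traceForm ℂ H L h y).re) hfin
    ⟨h', fun α => ⟨α, rfl⟩, fun _ _ => rfl⟩
  refine ⟨x, fun α => (hx.1 α).imp fun _ => Eq.symm, hx.2, fun γ hγ => ?_⟩
  have hreflection : x - γ x • coroot γ ∈ O := by
    refine ⟨fun α => ?_, fun g hg => ?_⟩
    · have : α (x - γ x • coroot γ) = reflectRoot γ α x := by
        rw [weight_sub_smul, mul_comm]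
        rfl
      exact this ▸ hx.1 _
    · rw [mem_weylInvariants_iff.1 hg γ hγ, hx.2 g hg]
  obtain ⟨c, hc, hcγ⟩ := exists_pos_traceForm_coroot hγ
  have hle := hmax _ hreflection
  have hsub : traceForm ℂ H L h (x - γ x • coroot γ) = traceForm ℂ H L h x - c * (γ h * γ x) := by
    rw [map_sub, map_smul, hcγ, smul_eq_mul]
    ring
  rw [hsub, Complex.sub_re, Complex.re_ofReal_mul] at hle
  exact nonneg_of_mul_nonneg_right (by linarith) hc

theorem weylInvariants_eq_of_adjointInvariants_eq {h h' : H} {z z' : Weight ℂ H L → ℤ}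
    (hz : ∀ α : Weight ℂ H L, α h = z α) (hz' : ∀ α : Weight ℂ H L, α h' = z' α)
    (hF : ∀ F ∈ adjointInvariants L, (F : L → ℂ) h = (F : L → ℂ) h')
    {g : PolyFun H} (hg : g ∈ weylInvariants H) : (g : H → ℂ) h = (g : H → ℂ) h' := by
  obtain ⟨x, hx, hxg, hpos⟩ := exists_dominant (L := L) h h'
  choose b hb using hx
  have hzx (α : Weight ℂ H L) : α x = z' (b α) := by rw [hb, hz']
  have hFx (F : PolyFun L) (hFi : F ∈ adjointInvariants L) : (F : L → ℂ) h = (F : L → ℂ) x :=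
    (hF F hFi).trans (hxg _ (restrict_mem_weylInvariants hFi)).symm
  have hdom (γ : Weight ℂ H L) (hγ : 0 < z γ) : 0 ≤ z' (b γ) := by
    have := hpos γ (isNonZero_of_intCast_weight_ne_zero hz hγ.ne')
    rw [hz, hzx, ← Int.cast_mul, Complex.intCast_re, Int.cast_nonneg_iff] at this
    exact nonneg_of_mul_nonneg_right this hγ
  have hcross : traceForm ℂ H L h x = traceForm ℂ H L h h := by
    simp only [traceForm_eq_sum_weight, hz, hzx]
    exact_mod_cast sum_weight_mul_eq hz hzx hdom hFx
  have hxh : x - h = 0 := by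
    refine eq_zero_of_traceForm_self_eq_zero (z := fun α => z' (b α) - z α) (fun α => ?_) ?_
    · rw [← one_smul ℂ h, weight_sub_smul, one_mul, hz, hzx, Int.cast_sub]
    · rw [LinearMap.map_sub₂, map_sub, map_sub, traceForm_comm ℂ H L x h, hcross,
        ← traceForm_self_eq_of_invariants_eq hFx, sub_self]
  rw [← hxg g hg, sub_eq_zero.1 hxh]

end Conjugacy

section Surjectivity

open LieAlgebra LieAlgebra.IsKilling LieModule Polynomial

theorem isIntegrallyClosed_adjointInvariants (L : Type*) [LieRing L] [LieAlgebra ℂ L]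
    [FiniteDimensional ℂ L] : IsIntegrallyClosed (adjointInvariants L) := by
  refine isIntegrallyClosed_of_saturated _ fun s hs hs0 F hsF x => ?_
  have hx := hsF x
  rw [Derivation.leibniz, hs x, smul_zero, add_zero, smul_eq_mul] at hx
  exact (mul_eq_zero.1 hx).resolve_left hs0

variable {L : Type*} [LieRing L] [LieAlgebra ℂ L] [FiniteDimensional ℂ L]
  [LieAlgebra.IsSemisimple ℂ L] {H : LieSubalgebra ℂ L} [H.IsCartanSubalgebra] {f : PolyFun H}

theorem exists_intCast_weight_of_mem_closure {h : H}
    (hh : h ∈ AddSubgroup.closure (Set.range fun α : H.root => coroot (α : Weight ℂ H L)))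
    (β : Weight ℂ H L) : ∃ n : ℤ, β h = n := by
  induction hh using AddSubgroup.closure_induction with
  | mem x hx =>
    obtain ⟨α, rfl⟩ := hx
    exact ⟨_, apply_coroot_eq_cast (α : Weight ℂ H L) β⟩
  | zero => exact ⟨0, by simp⟩
  | add x y _ _ hx hy =>
    obtain ⟨m, hm⟩ := hx
    obtain ⟨n, hn⟩ := hy
    exact ⟨m + n, by rw [Int.cast_add, ← hm, ← hn]; exact β.toLinear.map_add x y⟩
  | neg x _ hx =>
    obtain ⟨m, hm⟩ := hx
    exact ⟨-m, by rw [Int.cast_neg, ← hm]; exact β.toLinear.map_neg x⟩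

/-- The coroot lattice is Zariski dense in `H`, so that only integral points matter. -/
theorem pullback_eq_of_mem_weylInvariants {s : End ℂ H}
    (hs : ∀ α : Weight ℂ H L, ∃ β : Weight ℂ H L, ∀ x, α (s x) = β x)
    (hR : ∀ F ∈ adjointInvariants L, ∀ x : H, (F : L → ℂ) (s x) = (F : L → ℂ) x)
    (hf : f ∈ weylInvariants H) : pullback s f = f := by
  refine sub_eq_zero.1 <| eq_zero_of_forall_mem_addSubgroup
    (RootPairing.IsRootSystem.span_coroot_eq_top (P := rootSystem H)) fun h hh => sub_eq_zero.2 ?_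
  choose z hz using exists_intCast_weight_of_mem_closure (L := L) (h := h) hh
  choose b hb using hs
  exact weylInvariants_eq_of_adjointInvariants_eq (fun α => (hb α h).trans (hz (b α))) hz
    (fun F hF => hR F hF h) hf

variable (H) in
/-- The roots as polynomial functions on `H`. -/
def rootFun (α : H.root) : PolyFun H := linearPart H (α : Weight ℂ H L).toLinear

theorem span_root_eq_top :
    Submodule.span ℂ (Set.range fun α : H.root => (α : Weight ℂ H L).toLinear) = ⊤ :=
  RootPairing.IsRootSystem.span_root_eq_top (P := rootSystem H)

theorem apply_linearPart_mem_range {σ : PolyFun H →ₐ[ℂ] PolyFun H}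
    (hσ : ∀ α, ∃ β, σ (rootFun H α) = rootFun H β) (l : Dual ℂ H) :
    σ (linearPart H l) ∈ LinearMap.range (linearPart H) := by
  suffices ⊤ ≤ (LinearMap.range (linearPart H)).comap (σ.toLinearMap ∘ₗ linearPart H) from
    this Submodule.mem_top
  rw [← span_root_eq_top, Submodule.span_le]
  rintro _ ⟨α, rfl⟩
  obtain ⟨β, hβ⟩ := hσ α
  exact ⟨_, hβ.symm⟩

theorem apply_eq_of_mem_weylInvariants {σ : PolyFun H →ₐ[ℂ] PolyFun H}
    (hR : ∀ F ∈ adjointInvariants L, σ (restrict H F) = restrict H F)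
    (hσ : ∀ α, ∃ β, σ (rootFun H α) = rootFun H β) (hf : f ∈ weylInvariants H) : σ f = f := by
  obtain ⟨s, rfl⟩ := exists_eq_pullback (apply_linearPart_mem_range hσ)
  refine pullback_eq_of_mem_weylInvariants (fun α => ?_) (fun F hF x => ?_) hf
  · by_cases hα : α.IsZero
    · exact ⟨α, fun x => by rw [congrFun hα, congrFun hα]; rfl⟩
    · obtain ⟨β, hβ⟩ := hσ ⟨α, by simpa using hα⟩
      exact ⟨β, fun x => congrArg (evalAt x) hβ⟩
  · exact congrArg (evalAt x) (hR F hF)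

theorem adjoin_rootFun : Algebra.adjoin ℂ (Set.range (rootFun H)) = ⊤ :=
  adjoin_linearPart_of_span_eq_top span_root_eq_top

theorem restrict_injOn : Set.InjOn (restrict H) (adjointInvariants L) := fun F hF G hG h =>
  sub_eq_zero.1 <| eq_zero_of_restrict_eq_zero (H := H) (sub_mem hF hG) <| by
    rw [map_sub, h, sub_self]

theorem coeff_prod_rootFun_mem (n : ℕ) :
    (∏ α, (X - C (rootFun H α))).coeff n ∈ (adjointInvariants L).map (restrict H) := by
  refine coeff_prod_X_sub_C_mem (fun n hn => ?_) n
  exact sum_root_pow_mem_map_restrict hn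

theorem mem_map_restrict (hf : f ∈ weylInvariants H) :
    f ∈ (adjointInvariants L).map (restrict H) := by
  have := isIntegrallyClosed_adjointInvariants L
  exact mem_map_of_forall_algHom (a := rootFun H) restrict_injOn adjoin_rootFun
    coeff_prod_rootFun_mem fun _ hR hroot => apply_eq_of_mem_weylInvariants hR hroot hf

variable (H) in
/-- The restriction isomorphism `ℂ[L]^L ≃ ℂ[H]^W`. -/
def restrictEquiv : adjointInvariants L ≃ₐ[ℂ] weylInvariants H :=
  AlgEquiv.ofBijective (((restrict H).comp (adjointInvariants L).val).codRestrict (weylInvariants H)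
    fun F => restrict_mem_weylInvariants F.2) <| by
    refine ⟨fun F G h => ?_, fun f => ?_⟩
    · exact Subtype.ext (restrict_injOn F.2 G.2 (congrArg Subtype.val h))
    · obtain ⟨F, hF, hFf⟩ := mem_map_restrict f.2
      exact ⟨⟨F, hF⟩, Subtype.ext hFf⟩

theorem restrictEquiv_apply (F : adjointInvariants L) :
    (restrictEquiv H F : PolyFun H) = restrict H F := rfl

theorem restrict_mem_homogeneous_iff {F : PolyFun L} (hF : F ∈ adjointInvariants L) {n : ℕ} :
    restrict H F ∈ homogeneous H n ↔ F ∈ homogeneous L n := by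
  refine ⟨fun h => ?_, pullback_mem_homogeneous _ n F⟩
  let Fn : PolyFun L := DirectSum.decompose (homogeneous L) F n
  have hrestrict : restrict H Fn = restrict H F :=
    (map_decompose (homogeneous L) (homogeneous H) (f := (restrict H).toLinearMap)
      (pullback_mem_homogeneous _) F n).trans (DirectSum.decompose_of_mem_same _ h)
  exact restrict_injOn (isHomogeneous_adjointInvariants L n hF) hF hrestrict ▸ SetLike.coe_mem _

theorem map_degreePart (n : ℕ) :
    (degreePart (adjointInvariants L) n).map (restrictEquiv H).toLinearMap =
      degreePart (weylInvariants H) n := by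
  ext f
  obtain ⟨F, rfl⟩ := (restrictEquiv H).surjective f
  exact ((restrictEquiv H).injective.mem_set_image (s := degreePart (adjointInvariants L) n)).trans
    (restrict_mem_homogeneous_iff F.2).symm

end Surjectivity

end

end ChevalleyRestriction

open ChevalleyRestriction in
theorem mainTheorem6 {L : Type*} [LieRing L] [LieAlgebra ℂ L] [FiniteDimensional ℂ L]
    [LieAlgebra.IsSemisimple ℂ L] (H : LieSubalgebra ℂ L) [H.IsCartanSubalgebra] :
    (∀ F ∈ adjointInvariants L, restrict H F ∈ weylInvariants H) ∧
    Nonempty (GradedAlgebra (degreePart (adjointInvariants L))) ∧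
    Nonempty (GradedAlgebra (degreePart (weylInvariants H))) ∧
    ∃ e : adjointInvariants L ≃ₐ[ℂ] weylInvariants H,
      (∀ F : adjointInvariants L, (e F : PolyFun H) = restrict H F) ∧
      ∀ n : ℕ, (degreePart (adjointInvariants L) n).map e.toLinearMap =
        degreePart (weylInvariants H) n :=
  ⟨fun _ hF => restrict_mem_weylInvariants hF,
    nonempty_gradedAlgebra_comap_val _ _ (isHomogeneous_adjointInvariants L),
    nonempty_gradedAlgebra_comap_val _ _ (isHomogeneous_weylInvariants H),
    restrictEquiv H, restrictEquiv_apply, map_degreePart⟩
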